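/- Let $\mathcal H=\mathbb C\times\mathbb R$ be the 3-dimensional Heisenberg group with coordinates $(z,u)$, $z=x+iy$, and contact distribution spanned by $X=\partial_x-\tfrac y2\partial_u$ and $Y=\partial_y+\tfrac x2\partial_u$. Identify $\mathcal H\cup\{\infty\}$ with the unit sphere $S^3\subset\mathbb C^2$, the boundary of the unit ball $B$, by sending $(z,u)$ to $\left(\frac{2iz}{iw-1},\frac{iw+1}{iw-1}\right)$ with $w=-4u+i|z|^2$, and $\infty$ to $(0,1)$; the contact distribution of $\mathcal H$ then corresponds to the distribution of complex tangent lines of $S^3$, conformally for the metric in which $X,Y$ are orthonormal. A *Legendrian knot* is a smooth regular closed curve without self-intersections in $\mathcal H\cup\{\infty\}$ (it may or may not pass through $\infty$) that is everywhere tangent to the contact distribution. An *$\mathbb R$-circle* is the intersection of $S^3=\partial B$ with the closure of a complete totally geodesic, totally real surface in $B$ equipped with the complex hyperbolic metric. For distinct points $p,q$ there is exactly one $\mathbb R$-circle through $p$ and $q$ with a given horizontal tangent line at $p$. Let $K$ be a Legendrian knot. For distinct $p,q\in K$, let $\Gamma_K(p,q)$ be the $\mathbb R$-circle through $p$ and $q$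 that is tangent to $K$ at $p$. Let $\theta_K(p,q)\in[0,\pi]$ be the angle at $p$ between $\Gamma_K(p,q)$ and $\Gamma_K(q,p)$, where $K$ is given an arbitrary orientation, $\Gamma_K(p,q)$ is oriented in agreement with $K$ at $p$, and $\Gamma_K(q,p)$ is oriented in agreement with $K$ at $q$. (The value does not depend on the orientation of $K$.) **Proposition.** If $\theta_K(p,q)\in\{0,\pi\}$ for all $p,q\in K$ with $p\neq q$, then $K$ is an $\mathbb R$-circle, and hence $\theta_K(p,q)=0$ for all $p,q\in K$ with $p\ne q$. -/

import Mathlib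

open Set Topology
open scoped ContDiff InnerProductSpace

noncomputable section

namespace HeisKnot

/-- Complex Euclidean space `ℂ²`. -/
abbrev C2 : Type := EuclideanSpace ℂ (Fin 2)

/-- The Heisenberg group as a manifold, with coordinates `(z, u)`. -/
abbrev Heis : Type := ℂ × ℝ

/-- The one-point compactification of the Heisenberg group. -/
abbrev ExtHeis : Type := OnePoint Heis

/-! ### The identification of the compactified Heisenberg group with the unit sphere of `ℂ²` -/

/-- The inverse Cayley transform, sending `(z, w)` on the Siegel boundary `Im w = |z| ^ 2` to the
unit sphere; it is inverse to `ζ ↦ (ζ₁ / (i (ζ₂ - 1)), (ζ₂ + 1) / (i (ζ₂ - 1)))`. -/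
def cayleyInv (z w : ℂ) : C2 :=
  !₂[2 * Complex.I * z / (Complex.I * w - 1), (Complex.I * w + 1) / (Complex.I * w - 1)]

/-- `(z, u)` is identified with the point `(z, -4 u + i |z| ^ 2)` of the Siegel boundary, and hence
with a point of the unit sphere. -/
def heisToSphere (p : Heis) : C2 :=
  cayleyInv p.1 (-4 * (p.2 : ℂ) + Complex.I * ((‖p.1‖ : ℂ) ^ 2))

/-- The identification of `Heis ∪ {∞}` with the unit sphere of `ℂ²`; `∞` is sent to `(0, 1)`. -/
def toSphere : ExtHeis → C2
  | OnePoint.infty => !₂[0, 1]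
  | OnePoint.some p => heisToSphere p

/-! ### The contact distribution -/

/-- The vector field `X = ∂/∂x - (y / 2) ∂/∂u`. -/
def fieldX (p : Heis) : Heis := (1, -(p.1.im / 2))

/-- The vector field `Y = ∂/∂y + (x / 2) ∂/∂u`. -/
def fieldY (p : Heis) : Heis := (Complex.I, p.1.re / 2)

/-- The horizontal plane of the Heisenberg group at `p`, spanned by `X` and `Y`. -/
def horizontalPlane (p : Heis) : Submodule ℝ Heis := Submodule.span ℝ {fieldX p, fieldY p}

/-- The contact distribution of the unit sphere of `ℂ²`: the complex line of vectors Hermitian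
orthogonal to the point. It is the maximal complex subspace of the tangent space. -/
def contactPlane (x : C2) : Submodule ℂ C2 := (Submodule.span ℂ {x})ᗮ

/-- The quantity `1 + |z| ^ 2 + 4 i u`, the common denominator of the coordinates of the point of
the sphere that corresponds to `(z, u)`. -/
def den (p : Heis) : ℂ := 1 + (p.1.re ^ 2 + p.1.im ^ 2) + 4 * Complex.I * p.2

/-- The derivative of `den`. -/
def denDeriv (p v : Heis) : ℂ := 2 * (p.1.re * v.1.re + p.1.im * v.1.im) + 4 * Complex.I * v.2

lemma den_ne (p : Heis) : den p ≠ 0 := by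
  intro h
  have := congrArg Complex.re h
  simp [den, ← Complex.ofReal_pow] at this
  nlinarith [sq_nonneg p.1.re, sq_nonneg p.1.im]

lemma heisToSphere_eq (p : Heis) :
    heisToSphere p = !₂[-2 * Complex.I * p.1 / den p, 1 - 2 / den p] := by
  have h0 := den_ne p
  have hn : ((‖p.1‖ : ℂ) ^ 2) = (p.1.re ^ 2 + p.1.im ^ 2 : ℂ) := by
    rw [← Complex.ofReal_pow, Complex.sq_norm, Complex.normSq_apply]; push_cast; ring
  have h1 : Complex.I * (-4 * (p.2 : ℂ) + Complex.I * ((‖p.1‖ : ℂ) ^ 2)) - 1 = - den p := by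
    rw [hn, den]; linear_combination (p.1.re ^ 2 + p.1.im ^ 2 : ℂ) * Complex.I_sq
  have h2 : Complex.I * (-4 * (p.2 : ℂ) + Complex.I * ((‖p.1‖ : ℂ) ^ 2)) + 1 = 2 - den p := by
    rw [hn, den]; linear_combination (p.1.re ^ 2 + p.1.im ^ 2 : ℂ) * Complex.I_sq
  unfold heisToSphere cayleyInv
  rw [h1, h2]
  have e1 : 2 * Complex.I * p.1 / -den p = -2 * Complex.I * p.1 / den p := by
    field_simp
  have e2 : (2 - den p) / -den p = 1 - 2 / den p := by
    field_simp; ring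
  rw [e1, e2]

lemma norm_heisToSphere (p : Heis) : ‖heisToSphere p‖ = 1 := by
  have h0 := den_ne p
  have hN : 0 < Complex.normSq (den p) := Complex.normSq_pos.2 h0
  rw [← sq_eq_sq₀ (norm_nonneg _) zero_le_one, heisToSphere_eq, EuclideanSpace.norm_sq_eq]
  have e2 : 1 - 2 / den p = (den p - 2) / den p := by field_simp
  rw [e2]
  simp only [Fin.sum_univ_two, Complex.sq_norm, Matrix.cons_val_zero, Matrix.cons_val_one,
    Matrix.cons_val_fin_one, map_div₀]
  rw [← add_div, div_eq_iff hN.ne']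
  simp [Complex.normSq_apply, den, ← Complex.ofReal_pow]
  ring

lemma mem_horizontalPlane (p v : Heis) :
    v ∈ horizontalPlane p ↔ 2 * v.2 = p.1.re * v.1.im - p.1.im * v.1.re := by
  rw [horizontalPlane, Submodule.mem_span_pair]
  constructor
  · rintro ⟨a, b, rfl⟩
    simp [fieldX, fieldY]; ring
  · intro h
    refine ⟨v.1.re, v.1.im, Prod.ext (Complex.ext ?_ ?_) ?_⟩ <;> simp [fieldX, fieldY]
    linarith

/-- Under the identification with the sphere, the plane spanned by `X` and `Y` corresponds to the
contact distribution of the sphere, and the inner product for which `X` and `Y` are orthonormal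
corresponds to the Euclidean one up to a positive factor. -/
theorem heisToSphere_contact_conformal (p : Heis) :
    ∃ D : Heis →L[ℝ] C2, HasFDerivAt heisToSphere D p ∧
      (∀ v, D v ∈ contactPlane (heisToSphere p) ↔ v ∈ horizontalPlane p) ∧
      ∃ c : ℝ, 0 < c ∧ ∀ v ∈ horizontalPlane p, ∀ w ∈ horizontalPlane p,
        ⟪D v, D w⟫_ℂ = c * ⟪v.1, w.1⟫_ℂ := by
  have h0 := den_ne p
  have hN : 0 < Complex.normSq (den p) := Complex.normSq_pos.2 h0
  have h0' : (starRingEnd ℂ) (den p) ≠ 0 := by simpa using h0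
  have hdiff : DifferentiableAt ℝ heisToSphere p := by
    rw [show heisToSphere = _ from funext heisToSphere_eq]
    have hz : DifferentiableAt ℝ (fun q : Heis => q.1) p := differentiableAt_fst
    have hd : DifferentiableAt ℝ den p := by
      have hx : DifferentiableAt ℝ (fun q : Heis => (q.1.re : ℂ)) p :=
        (Complex.ofRealCLM.comp (Complex.reCLM.comp
          (ContinuousLinearMap.fst ℝ ℂ ℝ))).differentiableAt
      have hy : DifferentiableAt ℝ (fun q : Heis => (q.1.im : ℂ)) p :=
        (Complex.ofRealCLM.comp (Complex.imCLM.comp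
          (ContinuousLinearMap.fst ℝ ℂ ℝ))).differentiableAt
      have hu : DifferentiableAt ℝ (fun q : Heis => (q.2 : ℂ)) p :=
        (Complex.ofRealCLM.comp (ContinuousLinearMap.snd ℝ ℂ ℝ)).differentiableAt
      exact (((hx.pow 2).add (hy.pow 2)).const_add 1).add (hu.const_mul (4 * Complex.I))
    rw [differentiableAt_piLp]
    intro i
    fin_cases i
    · have h1 := (hz.const_mul (-2 * Complex.I)).mul (hd.inv h0)
      refine h1.congr_of_eventuallyEq (Filter.Eventually.of_forall fun q => ?_)
      simp [div_eq_mul_inv]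
    · simpa [div_eq_mul_inv] using (hd.inv h0).const_mul 2
  have hform : ∀ v : Heis, fderiv ℝ heisToSphere p v =
      !₂[2 * Complex.I * (p.1 * denDeriv p v - v.1 * den p) / den p ^ 2,
        2 * denDeriv p v / den p ^ 2] := by
    intro v
    have hline : HasDerivAt (fun t : ℝ => p + t • v) v 0 := by
      simpa using ((hasDerivAt_id (0 : ℝ)).smul_const v).const_add p
    have hc : HasDerivAt (fun t : ℝ => heisToSphere (p + t • v)) (fderiv ℝ heisToSphere p v) 0 := by
      have := hdiff.hasFDerivAt
      rw [show p = p + (0 : ℝ) • v by simp] at this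
      have h2 := this.comp_hasDerivAt (0 : ℝ) hline
      rw [show p + (0 : ℝ) • v = p by simp] at h2
      exact h2
    have hci (i : Fin 2) := (EuclideanSpace.proj (𝕜 := ℂ) i).restrictScalars ℝ
      |>.hasFDerivAt.comp_hasDerivAt (0 : ℝ) hc
    ext i
    refine (hci i).unique ?_
    clear hc hci
    have hu' (a b : ℝ) : HasDerivAt (fun t : ℝ => ((a + t * b : ℝ) : ℂ)) b 0 := by
      simpa using (((hasDerivAt_id (0 : ℝ)).mul_const b).const_add a).ofReal_comp
    have hz : HasDerivAt (fun t : ℝ => p.1 + (t : ℂ) * v.1) v.1 0 := by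
      simpa using (((hasDerivAt_id (0 : ℝ)).ofReal_comp).mul_const v.1).const_add p.1
    have hD : HasDerivAt (fun t : ℝ => den (p + t • v)) (denDeriv p v) 0 := by
      have := ((((hu' p.1.re v.1.re).pow 2).add ((hu' p.1.im v.1.im).pow 2)).const_add 1).add
        ((hu' p.2 v.2).const_mul (4 * Complex.I))
      have h2 := this.congr_deriv (h' := show _ = denDeriv p v by simp [denDeriv]; ring)
      refine h2.congr_of_eventuallyEq (Filter.Eventually.of_forall fun t => ?_)
      simp [den]
    have h0t : den (p + (0 : ℝ) • v) ≠ 0 := den_ne _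
    fin_cases i
    · have := ((hz.const_mul (-2 * Complex.I)).div hD h0t)
      have h2 := this.congr_deriv
        (h' := show _ = 2 * Complex.I * (p.1 * denDeriv p v - v.1 * den p) / den p ^ 2 by
          simp; ring)
      refine h2.congr_of_eventuallyEq (Filter.Eventually.of_forall fun t => ?_)
      simp [heisToSphere_eq]
    · have := ((hasDerivAt_const (0 : ℝ) (2 : ℂ)).div hD h0t).const_sub 1
      have h2 := this.congr_deriv (h' := show _ = 2 * denDeriv p v / den p ^ 2 by simp; ring)
      refine h2.congr_of_eventuallyEq (Filter.Eventually.of_forall fun t => ?_)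
      simp [heisToSphere_eq]
  refine ⟨_, hdiff.hasFDerivAt, fun v => ?_, 4 / Complex.normSq (den p), by positivity, ?_⟩
  · have hinner : ⟪heisToSphere p, fderiv ℝ heisToSphere p v⟫_ℂ =
        4 * Complex.I * ((p.1.re * v.1.im - p.1.im * v.1.re - 2 * v.2 : ℝ) : ℂ)
          / (den p * (starRingEnd ℂ) (den p)) := by
      rw [hform, heisToSphere_eq]
      simp only [PiLp.inner_apply, RCLike.inner_apply, Fin.sum_univ_two,
        Matrix.cons_val_zero, Matrix.cons_val_one, Matrix.cons_val_fin_one, map_div₀, map_mul,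
        map_sub, map_neg, Complex.conj_I, map_one, map_ofNat]
      rw [eq_div_iff (mul_ne_zero h0 h0')]
      field_simp
      apply Complex.ext <;>
      · simp [den, denDeriv, ← Complex.ofReal_pow]
        ring
    rw [contactPlane, Submodule.mem_orthogonal_singleton_iff_inner_right, hinner,
      mem_horizontalPlane, div_eq_zero_iff]
    simp only [mul_eq_zero, h0, h0', Complex.I_ne_zero, Complex.ofReal_eq_zero]
    norm_num
    constructor <;> intro h <;> linarith
  · intro v hv w hw
    have key : ∀ v ∈ horizontalPlane p, denDeriv p v = 2 * (starRingEnd ℂ) p.1 * v.1 := by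
      intro v hv
      rw [mem_horizontalPlane] at hv
      apply Complex.ext <;> simp [denDeriv] <;> linarith
    rw [hform, hform, key v hv, key w hw]
    have hns : (Complex.normSq (den p) : ℂ) = den p * (starRingEnd ℂ) (den p) :=
      (Complex.mul_conj _).symm
    simp only [PiLp.inner_apply, RCLike.inner_apply, Fin.sum_univ_two,
        Matrix.cons_val_zero, Matrix.cons_val_one, Matrix.cons_val_fin_one, map_div₀, map_mul,
        map_sub, Complex.conj_I, map_ofNat, map_pow, Complex.conj_conj]
    push_cast
    rw [hns]
    have hId : (p.1 * (2 * (starRingEnd ℂ) p.1) - den p) *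
        ((starRingEnd ℂ) p.1 * (2 * p.1) - (starRingEnd ℂ) (den p)) + 4 * p.1 * (starRingEnd ℂ) p.1
        = den p * (starRingEnd ℂ) (den p) := by
      apply Complex.ext <;>
      · simp [den, ← Complex.ofReal_pow]
        ring
    field_simp
    linear_combination (4 * w.1 * (starRingEnd ℂ) v.1) * hId -
      (4 * w.1 * (starRingEnd ℂ) v.1 * (p.1 * (2 * (starRingEnd ℂ) p.1) - den p) *
        ((starRingEnd ℂ) p.1 * (2 * p.1) - (starRingEnd ℂ) (den p))) * (Complex.I_sq)

/-! ### Legendrian knots -/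

/-- The velocity of a curve in `Heis ∪ {∞}`, seen as a tangent vector of the unit sphere. -/
def velocity (γ : ℝ → ExtHeis) (t : ℝ) : C2 := deriv (fun s => toSphere (γ s)) t

/-- `γ` is a periodic regular smooth parametrization of a Legendrian knot in `Heis ∪ {∞}`, that is,
of a closed Legendrian curve without self-intersections. -/
structure IsLegendrianParam (γ : ℝ → ExtHeis) : Prop where
  smooth : ContDiff ℝ ∞ (fun t => toSphere (γ t))
  regular : ∀ t, velocity γ t ≠ 0
  horizontal : ∀ t, velocity γ t ∈ contactPlane (toSphere (γ t))
  closed_simple : ∃ L : ℝ, 0 < L ∧ Function.Periodic γ L ∧ InjOn γ (Ico 0 L)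

/-- A (finite or infinite) Legendrian knot in `Heis ∪ {∞}`. -/
def IsLegendrianKnot (K : Set ExtHeis) : Prop :=
  ∃ γ : ℝ → ExtHeis, IsLegendrianParam γ ∧ range γ = K

/-! ### `ℝ`-circles -/

/-- The distance of the complex hyperbolic metric of the unit ball of `ℂ²`:
`cosh (d / 2) ^ 2 = |1 - ⟪z, w⟫| ^ 2 / ((1 - |z| ^ 2) (1 - |w| ^ 2))`. -/
def hyperbolicDist (z w : C2) : ℝ :=
  2 * Real.arcosh (‖1 - ⟪z, w⟫_ℂ‖ / √((1 - ‖z‖ ^ 2) * (1 - ‖w‖ ^ 2)))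

/-- A complete unit-speed geodesic of the complex hyperbolic plane. Since the complex hyperbolic
plane is complete, simply connected and negatively curved, these are exactly the curves `ℝ → ball`
that preserve distances. -/
def IsGeodesicLine (c : ℝ → C2) : Prop :=
  (∀ t, ‖c t‖ < 1) ∧ ∀ s t, hyperbolicDist (c s) (c t) = |s - t|

/-- `S` is a smooth embedded totally real surface in `ℂ²`: locally it is the zero set of a smooth
submersion `F` to the plane, and its tangent planes `ker dF` contain no complex line. -/
def IsTotallyRealSurface (S : Set C2) : Prop :=
  ∀ x ∈ S, ∃ (U : Set C2) (F : C2 → ℝ × ℝ), IsOpen U ∧ x ∈ U ∧ ContDiffOn ℝ ∞ F U ∧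
    S ∩ U = {y ∈ U | F y = 0} ∧
    (∀ y ∈ S ∩ U, Function.Surjective (fderiv ℝ F y)) ∧
    ∀ y ∈ S ∩ U, ∀ v : C2, fderiv ℝ F y v = 0 → fderiv ℝ F y (Complex.I • v) = 0 → v = 0

/-- `S` is a complete (connected) totally geodesic totally real surface in the unit ball of `ℂ²`.
Completeness and total geodesy are expressed by requiring that the complete ambient geodesic through
any two points of `S` stays in `S`. -/
structure IsRPlane (S : Set C2) : Prop where
  nonempty : S.Nonempty
  subset_ball : S ⊆ Metric.ball 0 1
  totallyReal : IsTotallyRealSurface S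
  totallyGeodesic : ∀ c : ℝ → C2, IsGeodesicLine c →
    ∀ s t : ℝ, s ≠ t → c s ∈ S → c t ∈ S → range c ⊆ S

/-- An `ℝ`-circle in `Heis ∪ {∞}`, identified with the unit sphere: the intersection of the sphere
with the closure of a complete totally geodesic totally real surface of the ball. -/
def IsRCircle (K : Set ExtHeis) : Prop :=
  ∃ S : Set C2, IsRPlane S ∧ toSphere '' K = closure S ∩ Metric.sphere 0 1

/-! ### The angle -/

/-- The angle in `[0, π]` between two nonzero vectors of `ℂ²` for the Euclidean inner product. -/
def vectorAngle (v w : C2) : ℝ := Real.arccos ((⟪v, w⟫_ℂ).re / (‖v‖ * ‖w‖))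

/-- `v` is a positive multiple of `w`. -/
def SameDirection (v w : C2) : Prop := ∃ c : ℝ, 0 < c ∧ v = c • w

/-- `α` is an oriented parametrization of an `ℝ`-circle that passes through `γ s` (at time `a`),
where it is tangent to `γ` with the same orientation, and through `q` (at time `b`). -/
structure IsTangentRCircle (γ : ℝ → ExtHeis) (s : ℝ) (q : ExtHeis)
    (α : ℝ → ExtHeis) (a b : ℝ) : Prop where
  param : IsLegendrianParam α
  rCircle : IsRCircle (range α)
  base : α a = γ s
  tangent : SameDirection (velocity α a) (velocity γ s)
  target : α b = q

/-- `θ` is the angle at `p` between the `ℝ`-circle through `p` and `q` tangent to `K` at `p` and the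
`ℝ`-circle through `p` and `q` tangent to `K` at `q`, both with the orientation induced by an
orientation of `K`. -/
def IsKnotAngle (K : Set ExtHeis) (p q : ExtHeis) (θ : ℝ) : Prop :=
  ∃ (γ : ℝ → ExtHeis) (s t : ℝ) (α β : ℝ → ExtHeis) (a a' b b' : ℝ),
    IsLegendrianParam γ ∧ range γ = K ∧ γ s = p ∧ γ t = q ∧
    IsTangentRCircle γ s q α a a' ∧ IsTangentRCircle γ t p β b b' ∧
    θ = vectorAngle (velocity α a) (velocity β b')

/-- The angle `θ_K(p, q)`, for distinct points `p` and `q` of a Legendrian knot `K`. -/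
def knotAngle (K : Set ExtHeis) (p q : ExtHeis) : ℝ :=
  Classical.epsilon (IsKnotAngle K p q)

end HeisKnot

end

/-! Write `x(s)` for the curve on the sphere and `H(s,t) = ⟪x(s), x(t)⟫ - 1`, the Hermitian product
of signature (2,1) of the lifts `(x(s), 1)` and `(x(t), 1)`. The proof reads the angle off the mixed
derivative `∂ₛ∂ₜ log H`, called `mixed`. Rescaling the lifts changes `log H` only by a function of
`s` plus a function of `t`, so `mixed` can be computed from any lifts (`mixed_proj`). It is
sesquilinear in the two velocities, and along an ℝ-circle it is a positive real number
(`mixed_pos`).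

The contact plane at `p` is a complex line, so the directions at `p` of the two tangent ℝ-circles
differ by a factor `z ∈ ℂ`, and the angle is `|arg z|`. Comparison with the ℝ-circle tangent at `q`
shows that `mixed` along `K` is a positive multiple of `conj z` (`exists_angle_eq`). Hence an angle
`0` or `π` means that `mixed` is real, and a positive `mixed` means that the angle is `0`.

If `mixed` is real off the diagonal, then `∂ₛ∂ₜ arg (-H) = 0` there. Since the curve is Legendrian,
`arg (-H)` tends to `0` at the diagonal (`tendsto_arg`), and so `arg (-H)` is additive along the
curve (`arg_add`). Therefore the triple product `H(s,u) H(u,t) H(t,s)` is real, which is the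
vanishing of Cartan's angular invariant (`cartan_im_eq_zero`). Points with vanishing invariant lie
on one ℝ-circle, because three of them determine an orthonormal frame in which all of them have real
coordinates (`exists_frame_of_cartan`). A closed regular curve in a circle covers it
(`isRCircle_range`), so `K` is an ℝ-circle; then `mixed` is positive and every angle is `0`.

Since ℝ-planes are defined geometrically, two bridges are needed: the real plane of a frame is an
ℝ-plane (`IsFrame.isRPlane`), and every ℝ-circle has vanishing Cartan invariant
(`IsRCircle.cartan_im`). -/

noncomputable section

namespace HeisKnot

open scoped ComplexConjugate

/-! ### The Hermitian form of signature `(2, 1)` -/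

/-- The Hermitian form of signature `(2, 1)` on `ℂ² × ℂ`, conjugate-linear on the left. -/
def form (X Y : C2 × ℂ) : ℂ := ⟪X.1, Y.1⟫_ℂ - conj X.2 * Y.2

/-- The homogeneous coordinates of a point of `ℂ²`. -/
def homog (x : C2) : C2 × ℂ := (x, 1)

/-- The point of `ℂ²` with given homogeneous coordinates. -/
def proj (X : C2 × ℂ) : C2 := X.2⁻¹ • X.1

lemma form_add_right (X Y Z : C2 × ℂ) : form X (Y + Z) = form X Y + form X Z := by
  simp [form]; ring

lemma form_add_left (X Y Z : C2 × ℂ) : form (X + Y) Z = form X Z + form Y Z := by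
  simp [form]; ring

lemma form_sub_right (X Y Z : C2 × ℂ) : form X (Y - Z) = form X Y - form X Z := by
  simp [form]; ring

lemma form_sub_left (X Y Z : C2 × ℂ) : form (X - Y) Z = form X Z - form Y Z := by
  simp [form]; ring

lemma form_smul_right (a : ℂ) (X Y : C2 × ℂ) : form X (a • Y) = a * form X Y := by
  simp [form]; ring

lemma form_smul_left (a : ℂ) (X Y : C2 × ℂ) : form (a • X) Y = conj a * form X Y := by
  simp [form]; ring

lemma form_conj (X Y : C2 × ℂ) : conj (form X Y) = form Y X := by
  simp [form, inner_conj_symm]; ring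

lemma form_self (X : C2 × ℂ) : form X X = ((‖X.1‖ ^ 2 - ‖X.2‖ ^ 2 : ℝ) : ℂ) := by
  simp [form, inner_self_eq_norm_sq_to_K, Complex.conj_mul']

lemma form_self_re (X : C2 × ℂ) : (form X X).re = ‖X.1‖ ^ 2 - ‖X.2‖ ^ 2 := by
  rw [form_self, Complex.ofReal_re]

lemma form_self_eq_re (X : C2 × ℂ) : form X X = ((form X X).re : ℂ) := by
  rw [form_self_re, form_self]

lemma form_homog (x y : C2) : form (homog x) (homog y) = ⟪x, y⟫_ℂ - 1 := by
  simp [form, homog]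

lemma form_homog_self (x : C2) : form (homog x) (homog x) = ((‖x‖ ^ 2 - 1 : ℝ) : ℂ) := by
  simp [form_self, homog]

lemma proj_homog (x : C2) : proj (homog x) = x := by simp [proj, homog]

lemma homog_proj {X : C2 × ℂ} (h : X.2 ≠ 0) : homog (proj X) = X.2⁻¹ • X := by
  ext1 <;> simp [homog, proj, h]

lemma proj_smul {a : ℂ} (ha : a ≠ 0) (X : C2 × ℂ) : proj (a • X) = proj X := by
  simp only [proj, Prod.smul_fst, Prod.smul_snd, smul_eq_mul, smul_smul]
  congr 1
  field_simp

lemma snd_ne_zero_of_nonpos {X : C2 × ℂ} (h : (form X X).re ≤ 0) (hX : X ≠ 0) : X.2 ≠ 0 := by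
  intro h2
  rw [form_self_re, h2] at h
  have : ‖X.1‖ = 0 := by
    have := norm_nonneg X.1
    simp at h
    simpa using h
  exact hX (Prod.ext (by simpa using this) h2)

lemma snd_ne_zero_of_neg {X : C2 × ℂ} (h : (form X X).re < 0) : X.2 ≠ 0 :=
  snd_ne_zero_of_nonpos h.le (by rintro rfl; simp [form] at h)

lemma norm_proj_sq {X : C2 × ℂ} (h : X.2 ≠ 0) :
    ‖proj X‖ ^ 2 = 1 + (form X X).re / ‖X.2‖ ^ 2 := by
  have : ‖X.2‖ ≠ 0 := by simpa using h
  rw [form_self_re, proj, norm_smul, norm_inv]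
  field_simp
  ring

lemma norm_proj_lt_one {X : C2 × ℂ} (h : (form X X).re < 0) : ‖proj X‖ < 1 := by
  have h2 := snd_ne_zero_of_neg h
  have : 0 < ‖X.2‖ := by simpa using h2
  rw [← sq_lt_one_iff₀ (norm_nonneg _), norm_proj_sq h2]
  have : (form X X).re / ‖X.2‖ ^ 2 < 0 := div_neg_of_neg_of_pos h (by positivity)
  linarith

lemma norm_proj_eq_one {X : C2 × ℂ} (h : form X X = 0) (h2 : X.2 ≠ 0) : ‖proj X‖ = 1 := by
  have := norm_proj_sq h2
  rw [h] at this
  rw [← sq_eq_sq₀ (norm_nonneg _) zero_le_one, this]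
  simp

/-- The form is positive definite on the orthogonal complement of a negative vector. -/
lemma form_pos_of_orthogonal {P U : C2 × ℂ} (hP : (form P P).re < 0) (hU : form P U = 0)
    (hU0 : U ≠ 0) : 0 < (form U U).re := by
  rw [form_self_re] at hP ⊢
  -- Orthogonality turns the Cauchy-Schwarz inequality in `ℂ²` into this bound; with `‖P.1‖ < ‖P.2‖`
  -- it forces `‖U.2‖ < ‖U.1‖`.
  have h1 : ‖P.2‖ * ‖U.2‖ ≤ ‖P.1‖ * ‖U.1‖ := by
    have : ⟪P.1, U.1⟫_ℂ = conj P.2 * U.2 := by simpa [form, sub_eq_zero] using hU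
    have h := norm_inner_le_norm (𝕜 := ℂ) P.1 U.1
    rw [this] at h
    simpa using h
  have hlt : ‖P.1‖ < ‖P.2‖ := by
    apply lt_of_pow_lt_pow_left₀ 2 (norm_nonneg _); linarith
  have hU1 : 0 < ‖U.1‖ := by
    by_contra hcon
    have h0 : ‖U.1‖ = 0 := le_antisymm (not_lt.1 hcon) (norm_nonneg _)
    have hP2 : 0 < ‖P.2‖ := lt_of_le_of_lt (norm_nonneg _) hlt
    have : ‖U.2‖ = 0 := by
      rw [h0] at h1
      nlinarith [norm_nonneg U.2]
    exact hU0 (Prod.ext (by simpa using h0) (by simpa using this))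
  have : ‖U.2‖ < ‖U.1‖ := by
    by_contra hcon
    push Not at hcon
    nlinarith [norm_nonneg P.1, norm_nonneg P.2]
  nlinarith [norm_nonneg U.2]

/-- The Cauchy-Schwarz inequality on the orthogonal complement of a negative vector. -/
lemma normSq_form_le {P U W : C2 × ℂ} (hP : (form P P).re < 0) (hU : form P U = 0)
    (hW : form P W = 0) :
    Complex.normSq (form U W) ≤ (form U U).re * (form W W).re := by
  by_cases hW0 : W = 0
  · subst hW0; simp [form]
  have hpos := form_pos_of_orthogonal hP hW hW0
  set n := (form W W).re with hn
  have hWW : form W W = (n : ℂ) := form_self_eq_re W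
  have hUU : form U U = ((form U U).re : ℂ) := form_self_eq_re U
  set m := (form U U).re with hm
  -- The component of `U` orthogonal to `W`, multiplied by `n` to avoid a division. It is still
  -- orthogonal to `P`, so its square `n (n m - |form U W|²)` is nonnegative.
  set Z : C2 × ℂ := (n : ℂ) • U - (form W U) • W with hZ
  have hZ0 : form P Z = 0 := by
    rw [hZ, form_sub_right, form_smul_right, form_smul_right, hU, hW]; simp
  have hZpos : 0 ≤ (form Z Z).re := by
    by_cases h : Z = 0
    · rw [h]; simp [form]
    · exact (form_pos_of_orthogonal hP hZ0 h).le
  have : form Z Z = ((n * (n * m - Complex.normSq (form U W)) : ℝ) : ℂ) := by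
    simp only [hZ, form_sub_left, form_sub_right, form_smul_left, form_smul_right, hWW, hUU,
      form_conj, Complex.conj_ofReal]
    have e : (Complex.normSq (form U W) : ℂ) = form U W * form W U := by
      rw [← form_conj U W, Complex.mul_conj]
    push_cast
    rw [e]; ring
  rw [this, Complex.ofReal_re] at hZpos
  have := nonneg_of_mul_nonneg_right hZpos hpos
  linarith [mul_comm n m]

/-- The angular factor `⟪x, y⟫ - 1` has negative real part for distinct points of the sphere. -/
lemma form_homog_re_neg {x y : C2} (hx : ‖x‖ = 1) (hy : ‖y‖ = 1) (hxy : x ≠ y) :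
    (form (homog x) (homog y)).re < 0 := by
  rw [form_homog]
  have h : 0 < ‖x - y‖ ^ 2 := by
    have : 0 < ‖x - y‖ := norm_pos_iff.2 (sub_ne_zero.2 hxy)
    positivity
  have := @norm_sub_sq ℂ _ _ _ _ x y
  simp only [hx, hy, RCLike.re_to_complex] at this
  simp only [Complex.sub_re, Complex.one_re]
  linarith

lemma form_homog_ne {x y : C2} (hx : ‖x‖ = 1) (hy : ‖y‖ = 1) (hxy : x ≠ y) :
    form (homog x) (homog y) ≠ 0 := by
  intro h
  have := form_homog_re_neg hx hy hxy
  rw [h] at this; simp at this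

/-! ### The identification with the sphere is bijective -/

lemma norm_toSphere (p : ExtHeis) : ‖toSphere p‖ = 1 := by
  induction p using OnePoint.rec with
  | infty => simp [toSphere, EuclideanSpace.norm_eq]
  | coe p => exact norm_heisToSphere p

lemma toSphere_injective : Function.Injective toSphere := by
  have hne (p : Heis) : toSphere p ≠ toSphere OnePoint.infty := by
    intro h
    have h := congrArg (fun x : C2 => x 1) h
    change heisToSphere p 1 = (!₂[0, 1] : C2) 1 at h
    rw [heisToSphere_eq] at h
    simp [den_ne] at h
  intro p q h
  induction p using OnePoint.rec with
  | infty =>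
    induction q using OnePoint.rec with
    | infty => rfl
    | coe q => exact absurd h.symm (hne q)
  | coe p =>
    induction q using OnePoint.rec with
    | infty => exact absurd h (hne p)
    | coe q =>
      change heisToSphere p = heisToSphere q at h
      rw [heisToSphere_eq, heisToSphere_eq] at h
      have h1 : 1 - 2 / den p = 1 - 2 / den q := congrArg (fun x : C2 => x 1) h
      have h0 : -2 * Complex.I * p.1 / den p = -2 * Complex.I * q.1 / den q :=
        congrArg (fun x : C2 => x 0) h
      have hd : den p = den q := by
        have hp := den_ne p
        have hq := den_ne q
        field_simp at h1
        have : 2 * (den p - den q) = 0 := by linear_combination h1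
        simpa [sub_eq_zero] using this
      have hz : p.1 = q.1 := by
        rw [hd] at h0
        have hq := den_ne q
        have hI := Complex.I_ne_zero
        field_simp at h0
        simpa using h0
      have hu : p.2 = q.2 := by
        have := congrArg Complex.im hd
        simpa [den, ← Complex.ofReal_pow] using this
      rw [Prod.ext hz hu]

lemma exists_toSphere_eq {y : C2} (hy : ‖y‖ = 1) : ∃ p, toSphere p = y := by
  have hn : Complex.normSq (y 0) + Complex.normSq (y 1) = 1 := by
    have := EuclideanSpace.norm_sq_eq y
    rw [hy] at this
    simp only [Fin.sum_univ_two, Complex.sq_norm] at this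
    linarith
  by_cases h1 : y 1 = 1
  · refine ⟨OnePoint.infty, ?_⟩
    have h0 : y 0 = 0 := by simpa [h1] using hn
    ext i
    fin_cases i <;> simp [toSphere, h0, h1]
  · have h1' : 1 - y 1 ≠ 0 := sub_ne_zero.2 (Ne.symm h1)
    -- By `heisToSphere_eq`, `d` must be the value of `den`, from the second coordinate; the first
    -- then gives `z`, and `d.im = 4 u`. The equation of the sphere is what makes `|z|² = d.re - 1`.
    set d : ℂ := 2 / (1 - y 1) with hd
    have hd0 : d ≠ 0 := by simp [hd, h1']
    set z : ℂ := y 0 * d * Complex.I / 2 with hz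
    have hden : den (z, d.im / 4) = d := by
      have hre : z.re ^ 2 + z.im ^ 2 = d.re - 1 := by
        have e : z.re ^ 2 + z.im ^ 2 = Complex.normSq z := by rw [Complex.normSq_apply]; ring
        have hN : Complex.normSq (1 - y 1) ≠ 0 := by simpa using h1'
        have hdd : d.re = 2 * (1 - (y 1).re) / Complex.normSq (1 - y 1) := by
          rw [hd, Complex.div_re]; simp
        rw [e, hdd, hz, hd]
        simp only [map_mul, map_div₀, Complex.normSq_I, Complex.normSq_ofNat]
        have : Complex.normSq (1 - y 1) = 1 - 2 * (y 1).re + Complex.normSq (y 1) := by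
          simp [Complex.normSq_apply]; ring
        field_simp
        rw [this]; linarith
      apply Complex.ext
      · simp [den, ← Complex.ofReal_pow, hre]
      · simp [den, ← Complex.ofReal_pow]
        ring
    refine ⟨((z, d.im / 4) : Heis), ?_⟩
    change heisToSphere _ = y
    rw [heisToSphere_eq, hden]
    ext i
    fin_cases i
    · simp only [Fin.zero_eta, Matrix.cons_val_zero]
      rw [hz]; field_simp
      simp
    · simp only [Fin.mk_one, Matrix.cons_val_one, Matrix.cons_val_fin_one]
      rw [hd]; field_simp; ring

/-- The inverse of the identification with the sphere. -/
def ofSphere : C2 → ExtHeis := Function.invFun toSphere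

lemma toSphere_ofSphere {y : C2} (hy : ‖y‖ = 1) : toSphere (ofSphere y) = y :=
  Function.invFun_eq (exists_toSphere_eq hy)

/-! ### Geodesics of the complex hyperbolic plane -/

lemma form_homog_proj {X Y : C2 × ℂ} (hX : X.2 ≠ 0) (hY : Y.2 ≠ 0) :
    form (homog (proj X)) (homog (proj Y)) = (conj X.2)⁻¹ * (Y.2)⁻¹ * form X Y := by
  rw [homog_proj hX, homog_proj hY, form_smul_left, form_smul_right, map_inv₀]; ring

/-- Numerator and denominator scale alike when representatives are rescaled, so any negative lifts
compute the distance. This allows lifts to be chosen with real mutual products. -/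
lemma hyperbolicDist_proj {X Y : C2 × ℂ} (hX : (form X X).re < 0) (hY : (form Y Y).re < 0) :
    hyperbolicDist (proj X) (proj Y) =
      2 * Real.arcosh (‖form X Y‖ / √((form X X).re * (form Y Y).re)) := by
  have hX2 := snd_ne_zero_of_neg hX
  have hY2 := snd_ne_zero_of_neg hY
  have hXn : 0 < ‖X.2‖ := by simpa using hX2
  have hYn : 0 < ‖Y.2‖ := by simpa using hY2
  have h1 : ‖1 - ⟪proj X, proj Y⟫_ℂ‖ = ‖form X Y‖ / (‖X.2‖ * ‖Y.2‖) := by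
    rw [← norm_neg, neg_sub, ← form_homog, form_homog_proj hX2 hY2]
    simp only [norm_mul, norm_inv, RCLike.norm_conj]
    field_simp
  have h2 : (1 - ‖proj X‖ ^ 2) * (1 - ‖proj Y‖ ^ 2) =
      (form X X).re * (form Y Y).re / (‖X.2‖ * ‖Y.2‖) ^ 2 := by
    rw [norm_proj_sq hX2, norm_proj_sq hY2]; field_simp; ring
  have h3 : 0 < (form X X).re * (form Y Y).re := mul_pos_of_neg_of_neg hX hY
  rw [hyperbolicDist, h1, h2, Real.sqrt_div h3.le, Real.sqrt_sq (by positivity)]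
  congr 2
  have := Real.sqrt_pos.2 h3
  field_simp

/-- The reverse Cauchy-Schwarz inequality for negative vectors. -/
lemma mul_le_normSq_form {X Y : C2 × ℂ} (hX : (form X X).re < 0) :
    (form X X).re * (form Y Y).re ≤ Complex.normSq (form X Y) := by
  set n := (form X X).re with hn
  have hn0 : (n : ℂ) ≠ 0 := by exact_mod_cast hX.ne
  have hXX : form X X = (n : ℂ) := form_self_eq_re X
  have hYY : form Y Y = ((form Y Y).re : ℂ) := form_self_eq_re Y
  set m := (form Y Y).re with hm
  -- Again a component cleared of denominators, now orthogonal to the negative vector `X`; as `n <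
  -- 0`, nonnegativity of its square reverses the usual inequality.
  set U : C2 × ℂ := (n : ℂ) • Y - (form X Y) • X with hU
  have hU0 : form X U = 0 := by
    rw [hU, form_sub_right, form_smul_right, form_smul_right, hXX]; ring
  have hpos : 0 ≤ (form U U).re := by
    by_cases h : U = 0
    · rw [h]; simp [form]
    · exact (form_pos_of_orthogonal hX hU0 h).le
  have : form U U = ((n * (n * m - Complex.normSq (form X Y)) : ℝ) : ℂ) := by
    simp only [hU, form_sub_left, form_sub_right, form_smul_left, form_smul_right, hXX, hYY,
      form_conj, Complex.conj_ofReal]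
    have e : (Complex.normSq (form X Y) : ℂ) = form X Y * form Y X := by
      rw [← form_conj X Y, Complex.mul_conj]
    push_cast
    rw [e]; ring
  rw [this, Complex.ofReal_re] at hpos
  nlinarith

/-- The curve traced by a hyperbola in a real plane of signature `(1, 1)` is a geodesic line. -/
lemma isGeodesicLine_hyperbola {P Q : C2 × ℂ} (hP : form P P = -1) (hQ : form Q Q = 1)
    (hPQ : form P Q = 0) :
    IsGeodesicLine
      (fun t : ℝ => proj ((Real.cosh (t / 2) : ℂ) • P + (Real.sinh (t / 2) : ℂ) • Q)) := by
  have hQP : form Q P = 0 := by rw [← form_conj, hPQ, map_zero]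
  set Z : ℝ → C2 × ℂ := fun t => (Real.cosh (t / 2) : ℂ) • P + (Real.sinh (t / 2) : ℂ) • Q with hZ
  have hform (s t : ℝ) : form (Z s) (Z t) = ((-Real.cosh ((s - t) / 2) : ℝ) : ℂ) := by
    simp only [hZ, form_add_left, form_add_right, form_smul_left, form_smul_right, hP, hQ, hPQ,
      hQP, Complex.conj_ofReal, sub_div, Real.cosh_sub]
    push_cast; ring
  have hneg (t : ℝ) : (form (Z t) (Z t)).re = -1 := by
    rw [hform]; simp
  have hneg' (t : ℝ) : (form (Z t) (Z t)).re < 0 := by rw [hneg]; norm_num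
  refine ⟨fun t => norm_proj_lt_one (hneg' t), fun s t => ?_⟩
  rw [hyperbolicDist_proj (hneg' s) (hneg' t), hneg, hneg, hform, Complex.norm_real, norm_neg,
    Real.norm_of_nonneg (Real.cosh_pos _).le]
  have : Real.cosh ((s - t) / 2) = Real.cosh (|s - t| / 2) := by
    rw [← Real.cosh_abs, abs_div, abs_two]
  rw [this]
  norm_num
  rw [Real.arcosh_cosh (by positivity)]
  ring

/-- There is a geodesic line through any two points of the ball; it consists of the points
represented by real combinations of suitably scaled representatives. -/
lemma exists_geodesicLine {A B : C2 × ℂ} (hA : (form A A).re < 0) (hB : (form B B).re < 0)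
    (hAB : (form A B).im = 0) (hne : proj A ≠ proj B) :
    ∃ c, IsGeodesicLine c ∧ ∀ x y : ℝ,
      (form ((x : ℂ) • A + (y : ℂ) • B) ((x : ℂ) • A + (y : ℂ) • B)).re < 0 →
        proj ((x : ℂ) • A + (y : ℂ) • B) ∈ range c := by
  set a := -(form A A).re with ha
  have ha0 : 0 < a := by linarith
  have hsa : 0 < √a := Real.sqrt_pos.2 ha0
  have hsac : (√a : ℂ) ≠ 0 := by exact_mod_cast hsa.ne'
  have hsa2 : (√a : ℂ) ^ 2 = a := by exact_mod_cast Real.sq_sqrt ha0.le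
  have hac : (a : ℂ) ≠ 0 := by exact_mod_cast ha0.ne'
  have hAA : form A A = -(a : ℂ) := by rw [form_self_eq_re A, ha]; push_cast; ring
  set k := (form A B).re with hk
  have hABk : form A B = (k : ℂ) := Complex.ext (by simp [hk]) (by simpa using hAB)
  -- Gram-Schmidt against `A`, where `form A A = -a`. Because `form A B` is real, the coefficient is
  -- real, and real combinations of `A`, `B` remain real combinations of `P`, `Q`.
  set U : C2 × ℂ := B + ((k / a : ℝ) : ℂ) • A with hU
  have hAU : form A U = 0 := by
    rw [hU, form_add_right, form_smul_right, hAA, hABk]; push_cast; field_simp; ring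
  have hU0 : U ≠ 0 := by
    intro h
    have hBA : B = ((-(k / a) : ℝ) : ℂ) • A := by
      rw [hU, add_eq_zero_iff_eq_neg] at h
      rw [h, Complex.ofReal_neg, neg_smul]
    have h0 : ((-(k / a) : ℝ) : ℂ) ≠ 0 := by
      intro h0
      rw [h0, zero_smul] at hBA
      rw [hBA] at hB; simp [form] at hB
    exact hne (by rw [hBA, proj_smul h0])
  have hn0 := form_pos_of_orthogonal hA hAU hU0
  set n := (form U U).re with hn
  have hUU : form U U = (n : ℂ) := form_self_eq_re U
  have hsn : 0 < √n := Real.sqrt_pos.2 hn0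
  have hsnc : (√n : ℂ) ≠ 0 := by exact_mod_cast hsn.ne'
  have hsn2 : (√n : ℂ) ^ 2 = n := by exact_mod_cast Real.sq_sqrt hn0.le
  have hnc : (n : ℂ) ≠ 0 := by exact_mod_cast hn0.ne'
  set P : C2 × ℂ := ((√a)⁻¹ : ℂ) • A with hP
  set Q : C2 × ℂ := ((√n)⁻¹ : ℂ) • U with hQ
  have hPP : form P P = -1 := by
    rw [hP, form_smul_left, form_smul_right, hAA, map_inv₀, Complex.conj_ofReal]
    field_simp; rw [hsa2]
  have hQQ : form Q Q = 1 := by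
    rw [hQ, form_smul_left, form_smul_right, hUU, map_inv₀, Complex.conj_ofReal]
    field_simp; rw [hsn2]
  have hPQ : form P Q = 0 := by
    rw [hP, hQ, form_smul_left, form_smul_right, hAU]; simp
  have hQP : form Q P = 0 := by rw [← form_conj, hPQ, map_zero]
  refine ⟨_, isGeodesicLine_hyperbola hPP hQQ hPQ, fun x y hxy => ?_⟩
  set x' : ℝ := (x - y * k / a) * √a with hx'
  set y' : ℝ := y * √n with hy'
  have hZ : (x : ℂ) • A + (y : ℂ) • B = (x' : ℂ) • P + (y' : ℂ) • Q := by
    have hAP : A = (√a : ℂ) • P := by rw [hP, smul_smul, mul_inv_cancel₀ hsac, one_smul]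
    have hUQ : U = (√n : ℂ) • Q := by rw [hQ, smul_smul, mul_inv_cancel₀ hsnc, one_smul]
    rw [hx', hy', Complex.ofReal_mul, Complex.ofReal_mul, mul_smul, mul_smul, ← hAP, ← hUQ, hU]
    push_cast
    module
  rw [hZ] at hxy ⊢
  have hneg : y' ^ 2 < x' ^ 2 := by
    have : form ((x' : ℂ) • P + (y' : ℂ) • Q) ((x' : ℂ) • P + (y' : ℂ) • Q) =
        ((y' ^ 2 - x' ^ 2 : ℝ) : ℂ) := by
      simp only [form_add_left, form_add_right, form_smul_left, form_smul_right, hPP, hQQ, hPQ,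
        hQP, Complex.conj_ofReal]
      push_cast; ring
    rw [this, Complex.ofReal_re] at hxy
    linarith
  have hx0 : x' ≠ 0 := by
    rintro h; rw [h] at hneg; nlinarith [sq_nonneg y']
  have hτ : (y' / x') ^ 2 < 1 := by
    rw [div_pow, div_lt_one (by positivity)]; exact hneg
  have hτ' : y' / x' ∈ Ioo (-1 : ℝ) 1 := abs_lt.1 ((sq_lt_one_iff_abs_lt_one _).1 hτ)
  have hs : 0 < √(1 - (y' / x') ^ 2) := Real.sqrt_pos.2 (by linarith)
  -- The parameter at which `sinh (t/2) / cosh (t/2)` equals `y' / x'`. The two lifts then differ by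
  -- the factor `x' √(1 - (y'/x')²)`, whatever the sign of `x'`.
  refine ⟨2 * Real.artanh (y' / x'), ?_⟩
  have e : 2 * Real.artanh (y' / x') / 2 = Real.artanh (y' / x') := by ring
  simp only [e, Real.cosh_artanh hτ', Real.sinh_artanh hτ']
  rw [← proj_smul (a := ((x' * √(1 - (y' / x') ^ 2) : ℝ) : ℂ))
    (by exact_mod_cast (mul_ne_zero hx0 hs.ne'))]
  congr 1
  simp only [smul_add, smul_smul, ← Complex.ofReal_mul]
  generalize √(1 - (y' / x') ^ 2) = q at hs
  congr 3
  · field_simp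
  · field_simp

/-- The case of equality in the hyperbolic triangle inequality. -/
lemma eq_combination_of_cosh {P Y Z : C2 × ℂ} {a b : ℝ} (ha : a ≠ 0) (hP : form P P = -1)
    (hY : form Y Y = -1) (hZ : form Z Z = -1) (hPY : form P Y = -(Real.cosh a : ℂ))
    (hPZ : form P Z = -(Real.cosh b : ℂ)) (hYZ : ‖form Y Z‖ = Real.cosh (a - b)) :
    Z = (Real.cosh b : ℂ) • P +
      ((Real.sinh b / Real.sinh a : ℝ) : ℂ) • (Y - (Real.cosh a : ℂ) • P) := by
  have hYP : form Y P = -(Real.cosh a : ℂ) := by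
    rw [← form_conj, hPY, map_neg, Complex.conj_ofReal]
  have hZP : form Z P = -(Real.cosh b : ℂ) := by
    rw [← form_conj, hPZ, map_neg, Complex.conj_ofReal]
  set U : C2 × ℂ := Y - (Real.cosh a : ℂ) • P with hU
  set W : C2 × ℂ := Z - (Real.cosh b : ℂ) • P with hW
  have hPneg : (form P P).re < 0 := by rw [hP]; simp
  have hPU : form P U = 0 := by
    rw [hU, form_sub_right, form_smul_right, hPY, hP]; ring
  have hPW : form P W = 0 := by
    rw [hW, form_sub_right, form_smul_right, hPZ, hP]; ring
  have hca : (Real.cosh a : ℂ) ^ 2 - (Real.sinh a : ℂ) ^ 2 = 1 := by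
    exact_mod_cast Real.cosh_sq_sub_sinh_sq a
  have hcb : (Real.cosh b : ℂ) ^ 2 - (Real.sinh b : ℂ) ^ 2 = 1 := by
    exact_mod_cast Real.cosh_sq_sub_sinh_sq b
  have hUU : form U U = ((Real.sinh a ^ 2 : ℝ) : ℂ) := by
    simp only [hU, form_sub_left, form_sub_right, form_smul_left, form_smul_right, hP, hY, hPY,
      hYP, Complex.conj_ofReal]
    push_cast at hca ⊢
    linear_combination hca
  have hWW : form W W = ((Real.sinh b ^ 2 : ℝ) : ℂ) := by
    simp only [hW, form_sub_left, form_sub_right, form_smul_left, form_smul_right, hP, hZ, hPZ,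
      hZP, Complex.conj_ofReal]
    push_cast at hcb ⊢
    linear_combination hcb
  set ζ := form U W with hζ
  have hζeq : form Y Z = ζ - ((Real.cosh a * Real.cosh b : ℝ) : ℂ) := by
    simp only [hζ, hU, hW, form_sub_left, form_sub_right, form_smul_left, form_smul_right, hP,
      hYP, hPZ, Complex.conj_ofReal]
    push_cast; ring
  have hcs := normSq_form_le hPneg hPU hPW
  rw [hUU, hWW, ← hζ, Complex.ofReal_re, Complex.ofReal_re, Complex.normSq_apply] at hcs
  have hN : (ζ.re - Real.cosh a * Real.cosh b) ^ 2 + ζ.im ^ 2 =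
      (Real.cosh a * Real.cosh b - Real.sinh a * Real.sinh b) ^ 2 := by
    have := congrArg (· ^ 2) hYZ
    simp only [Complex.sq_norm, hζeq, Real.cosh_sub] at this
    rw [Complex.normSq_apply] at this
    simp only [Complex.sub_re, Complex.ofReal_re, Complex.sub_im, Complex.ofReal_im] at this
    linarith
  have hlt : |Real.sinh a * Real.sinh b| < Real.cosh a * Real.cosh b := by
    rw [abs_mul]
    have h1 : |Real.sinh a| < Real.cosh a :=
      abs_lt_of_sq_lt_sq (by nlinarith [Real.cosh_sq_sub_sinh_sq a]) (Real.cosh_pos a).le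
    have h2 : |Real.sinh b| < Real.cosh b :=
      abs_lt_of_sq_lt_sq (by nlinarith [Real.cosh_sq_sub_sinh_sq b]) (Real.cosh_pos b).le
    exact mul_lt_mul'' h1 h2 (abs_nonneg _) (abs_nonneg _)
  have hcpos : 0 < Real.cosh a * Real.cosh b := mul_pos (Real.cosh_pos a) (Real.cosh_pos b)
  set cc := Real.cosh a * Real.cosh b with hcc
  set ss := Real.sinh a * Real.sinh b with hss
  have hcs' : ζ.re ^ 2 + ζ.im ^ 2 ≤ ss ^ 2 := by rw [hss]; nlinarith
  have h1 : ζ.re ≤ ss := by nlinarith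
  -- By `hN`, `ζ` lies on the circle with centre `cc` and radius `cc - ss`; by Cauchy-Schwarz, it
  -- lies in the disc of radius `|ss|` about `0`. The two are tangent and meet only at `ss`.
  have hre : |ζ.re| ≤ |ss| := sq_le_sq.1 (by nlinarith [sq_nonneg ζ.im])
  have h2 : ss ≤ ζ.re := by
    by_contra hcon
    push Not at hcon
    have : 0 < 2 * cc - ζ.re - ss := by
      linarith [le_abs_self ζ.re, le_abs_self ss]
    nlinarith [sq_nonneg ζ.im, mul_pos (sub_pos.2 hcon) this]
  have hζre : ζ.re = ss := le_antisymm h1 h2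
  have hζim : ζ.im = 0 := by
    rw [hζre] at hcs'; nlinarith [sq_nonneg ζ.im]
  have hζ' : ζ = (ss : ℂ) := Complex.ext (by simpa using hζre) (by simpa using hζim)
  have hWU : form W U = (ss : ℂ) := by
    rw [← form_conj, ← hζ, hζ', Complex.conj_ofReal]
  -- Equality in Cauchy-Schwarz makes this vector null, and it is orthogonal to the negative vector
  -- `P`, where the form is definite.
  set T : C2 × ℂ := (Real.sinh a : ℂ) • W - (Real.sinh b : ℂ) • U with hT
  have hTT : form T T = 0 := by
    simp only [hT, form_sub_left, form_sub_right, form_smul_left, form_smul_right, hUU, hWW,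
      ← hζ, hζ', hWU, Complex.conj_ofReal, hss]
    push_cast; ring
  have hPT : form P T = 0 := by
    rw [hT, form_sub_right, form_smul_right, form_smul_right, hPU, hPW]; simp
  have hT0 : T = 0 := by
    by_contra h
    have := form_pos_of_orthogonal hPneg hPT h
    rw [hTT] at this; simp at this
  have hsa : (Real.sinh a : ℂ) ≠ 0 := by
    exact_mod_cast fun h => ha (Real.sinh_eq_zero.1 h)
  have hWe : W = ((Real.sinh b / Real.sinh a : ℝ) : ℂ) • U := by
    have : (Real.sinh a : ℂ) • W = (Real.sinh b : ℂ) • U := sub_eq_zero.1 hT0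
    rw [Complex.ofReal_div, div_eq_inv_mul, mul_smul, ← this, smul_smul,
      inv_mul_cancel₀ hsa, one_smul]
  rw [← hWe, hW]; abel

lemma norm_form_of_geodesicLine {c : ℝ → C2} (hc : IsGeodesicLine c) {s t : ℝ} {X Y : C2 × ℂ}
    (hX : form X X = -1) (hY : form Y Y = -1) (hXs : proj X = c s) (hYt : proj Y = c t) :
    ‖form X Y‖ = Real.cosh ((s - t) / 2) := by
  have h := hc.2 s t
  rw [← hXs, ← hYt, hyperbolicDist_proj (by rw [hX]; simp) (by rw [hY]; simp), hX, hY] at h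
  norm_num at h
  have h1 : 1 ≤ ‖form X Y‖ := by
    have := mul_le_normSq_form (X := X) (Y := Y) (by rw [hX]; simp)
    rw [hX, hY, Complex.normSq_eq_norm_sq] at this
    norm_num at this
    exact this
  rw [← Real.cosh_arcosh h1, ← Real.cosh_abs ((s - t) / 2), abs_div, abs_two, ← h]
  congr 1; ring

/-- Any point of a geodesic line is represented by a real combination of suitably scaled
representatives of two distinct points of the line. -/
lemma IsGeodesicLine.exists_combination {c : ℝ → C2} (hc : IsGeodesicLine c) {s t : ℝ}
    (hst : s ≠ t) {X Y : C2 × ℂ} (hX : (form X X).re < 0) (hY : (form Y Y).re < 0)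
    (hXs : proj X = c s) (hYt : proj Y = c t) (hXY : (form X Y).im = 0) (r : ℝ) :
    ∃ x y : ℝ, ((x : ℂ) • X + (y : ℂ) • Y).2 ≠ 0 ∧ proj ((x : ℂ) • X + (y : ℂ) • Y) = c r := by
  have hnorm (V : C2 × ℂ) (hV : (form V V).re < 0) (μ : ℂ) (hμ : Complex.normSq μ = 1) :
      form ((μ / √(-(form V V).re) : ℂ) • V) ((μ / √(-(form V V).re) : ℂ) • V) = -1 := by
    have h0 : 0 < -(form V V).re := by linarith
    have h1 : (√(-(form V V).re) : ℂ) ≠ 0 := by exact_mod_cast (Real.sqrt_pos.2 h0).ne'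
    have h2 : (√(-(form V V).re) : ℂ) ^ 2 = -form V V := by
      rw [form_self_eq_re V]; exact_mod_cast Real.sq_sqrt h0.le
    have h3 : conj μ * μ = 1 := by rw [mul_comm, Complex.mul_conj, hμ]; simp
    rw [form_smul_left, form_smul_right, map_div₀, Complex.conj_ofReal]
    field_simp
    rw [h2]
    linear_combination (form V V) * h3
  have hrs : (form (homog (c r)) (homog (c r))).re < 0 := by
    rw [form_homog_self, Complex.ofReal_re]
    have := hc.1 r
    nlinarith [norm_nonneg (c r)]
  set k := (form X Y).re with hk
  have hXYk : form X Y = (k : ℂ) := Complex.ext (by simp [hk]) (by simpa using hXY)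
  have hk0 : k ≠ 0 := by
    intro h
    have := mul_le_normSq_form (X := X) (Y := Y) hX
    rw [hXYk, h] at this
    simp at this
    nlinarith
  -- The sign that makes the product of the two normalized lifts negative, as
  -- `eq_combination_of_cosh` requires.
  set σ : ℝ := -SignType.sign k with hσ
  have hσ2 : σ * σ = 1 := by
    rcases lt_or_gt_of_ne hk0 with h | h
    · simp [hσ, sign_neg h]
    · simp [hσ, sign_pos h]
  have hσk : σ * k = -|k| := by
    rw [hσ, neg_mul, sign_mul_self]
  have h0X : 0 < √(-(form X X).re) := Real.sqrt_pos.2 (by linarith)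
  have h0Y : 0 < √(-(form Y Y).re) := Real.sqrt_pos.2 (by linarith)
  set P : C2 × ℂ := (1 / √(-(form X X).re) : ℂ) • X with hPdef
  set Y' : C2 × ℂ := (σ / √(-(form Y Y).re) : ℂ) • Y with hYdef
  have hPP : form P P = -1 := hnorm X hX 1 (by simp)
  have hYY : form Y' Y' = -1 := hnorm Y hY σ (by simp [hσ2])
  have hPs : proj P = c s := by
    rw [hPdef, proj_smul _ X, hXs]
    exact one_div_ne_zero (by exact_mod_cast h0X.ne')
  have hσ0 : σ ≠ 0 := by rintro h; simp [h] at hσ2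
  have hYt' : proj Y' = c t := by
    rw [hYdef, proj_smul _ Y, hYt]
    exact div_ne_zero (by exact_mod_cast hσ0) (by exact_mod_cast h0Y.ne')
  have hPY : form P Y' = -(Real.cosh ((s - t) / 2) : ℂ) := by
    rw [← norm_form_of_geodesicLine hc hPP hYY hPs hYt']
    have : form P Y' = ((-(|k| / (√(-(form X X).re) * √(-(form Y Y).re))) : ℝ) : ℂ) := by
      rw [hPdef, hYdef, form_smul_left, form_smul_right, hXYk, ← neg_div, ← hσk]
      simp only [map_div₀, map_one, Complex.conj_ofReal]
      push_cast
      field_simp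
    rw [this, Complex.norm_real, norm_neg, Real.norm_of_nonneg (by positivity)]
    push_cast; ring
  -- normalization of the third point
  set R : C2 × ℂ := homog (c r) with hR
  have h0R : 0 < √(-(form R R).re) := Real.sqrt_pos.2 (by linarith)
  have hPR : form P R ≠ 0 := by
    intro h
    have := mul_le_normSq_form (X := P) (Y := R) (by rw [hPP]; simp)
    rw [h, hPP] at this
    simp at this
    linarith
  -- The unit factor that rotates the third lift until its product with `P` is a negative real
  -- number.
  set μ : ℂ := -(conj (form P R) / ‖form P R‖) with hμ
  have hPRn : (‖form P R‖ : ℂ) ≠ 0 := by simpa using hPR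
  have hμμ : μ * form P R = -(‖form P R‖ : ℂ) := by
    rw [hμ]; field_simp; rw [Complex.conj_mul']
  have hμ1 : Complex.normSq μ = 1 := by
    have : ‖form P R‖ ≠ 0 := by simpa using hPR
    rw [hμ, Complex.normSq_neg, Complex.normSq_div, Complex.normSq_conj, Complex.normSq_ofReal,
      Complex.normSq_eq_norm_sq]
    field_simp
  have hμ0 : μ ≠ 0 := by rintro h; simp [h] at hμ1
  set Z : C2 × ℂ := (μ / √(-(form R R).re) : ℂ) • R with hZdef
  have hcoef : (μ / √(-(form R R).re) : ℂ) ≠ 0 := div_ne_zero hμ0 (by exact_mod_cast h0R.ne')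
  have hZZ : form Z Z = -1 := hnorm R hrs μ hμ1
  have hZr : proj Z = c r := by
    rw [hZdef, proj_smul hcoef, hR, proj_homog]
  have hPZ : form P Z = -(Real.cosh ((s - r) / 2) : ℂ) := by
    rw [← norm_form_of_geodesicLine hc hPP hZZ hPs hZr]
    have : form P Z = ((-(‖form P R‖ / √(-(form R R).re)) : ℝ) : ℂ) := by
      rw [hZdef, form_smul_right, div_mul_eq_mul_div, hμμ]
      push_cast; ring
    rw [this, Complex.norm_real, norm_neg, Real.norm_of_nonneg (by positivity)]
    push_cast; ring
  have hYZ : ‖form Y' Z‖ = Real.cosh ((s - t) / 2 - (s - r) / 2) := by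
    rw [norm_form_of_geodesicLine hc hYY hZZ hYt' hZr, ← Real.cosh_neg]; congr 1; ring
  have ha : (s - t) / 2 ≠ 0 := div_ne_zero (sub_ne_zero.2 hst) two_ne_zero
  have key := eq_combination_of_cosh ha hPP hYY hZZ hPY hPZ hYZ
  set q : ℝ := Real.sinh ((s - r) / 2) / Real.sinh ((s - t) / 2) with hq
  refine ⟨(Real.cosh ((s - r) / 2) - q * Real.cosh ((s - t) / 2)) / √(-(form X X).re),
    q * σ / √(-(form Y Y).re), ?_⟩
  have e : ((((Real.cosh ((s - r) / 2) - q * Real.cosh ((s - t) / 2)) /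
      √(-(form X X).re) : ℝ) : ℂ) • X + ((q * σ / √(-(form Y Y).re) : ℝ) : ℂ) • Y) = Z := by
    rw [key, hPdef, hYdef]
    simp only [smul_sub, smul_smul]
    push_cast
    module
  rw [e]
  exact ⟨snd_ne_zero_of_neg (by rw [hZZ]; simp), hZr⟩

/-! ### Totally real totally geodesic surfaces -/

/-- Total geodesy in linear terms: a geodesic is swept out by the negative real combinations of two
lifts with real product. -/
lemma IsRPlane.proj_mem {S : Set C2} (hS : IsRPlane S) {A B : C2 × ℂ}
    (hA : (form A A).re < 0) (hB : (form B B).re < 0) (hAB : (form A B).im = 0)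
    (hAS : proj A ∈ S) (hBS : proj B ∈ S) {x y : ℝ}
    (hxy : (form ((x : ℂ) • A + (y : ℂ) • B) ((x : ℂ) • A + (y : ℂ) • B)).re < 0) :
    proj ((x : ℂ) • A + (y : ℂ) • B) ∈ S := by
  -- For coinciding points there is no geodesic to follow, but every nonzero combination represents
  -- the same point.
  by_cases hne : proj A = proj B
  · have hA2 := snd_ne_zero_of_neg hA
    have hB2 := snd_ne_zero_of_neg hB
    have eA : A = A.2 • homog (proj A) := by
      rw [homog_proj hA2, smul_smul, mul_inv_cancel₀ hA2, one_smul]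
    have eB : B = B.2 • homog (proj A) := by
      rw [hne, homog_proj hB2, smul_smul, mul_inv_cancel₀ hB2, one_smul]
    have e : (x : ℂ) • A + (y : ℂ) • B = ((x : ℂ) * A.2 + (y : ℂ) * B.2) • homog (proj A) := by
      rw [add_smul, mul_smul, mul_smul, ← eA, ← eB]
    have h0 : (x : ℂ) * A.2 + (y : ℂ) * B.2 ≠ 0 := by
      intro h
      rw [e, h, zero_smul] at hxy
      simp [form] at hxy
    rw [e, proj_smul h0, proj_homog]
    exact hAS
  · obtain ⟨c, hc, hcomb⟩ := exists_geodesicLine hA hB hAB hne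
    obtain ⟨s, hs⟩ : proj A ∈ range c := by
      simpa using hcomb 1 0 (by simpa using hA)
    obtain ⟨t, ht⟩ : proj B ∈ range c := by
      simpa using hcomb 0 1 (by simpa using hB)
    have hst : s ≠ t := by
      rintro rfl; exact hne (hs.symm.trans ht)
    exact hS.totallyGeodesic c hc s t hst (hs ▸ hAS) (ht ▸ hBS) (hcomb x y hxy)

/-- The representative of `a` whose product with the representative of `x₀` is `-1`. -/
def normalizedLift (x₀ a : C2) : C2 × ℂ := (1 - ⟪x₀, a⟫_ℂ)⁻¹ • homog a

lemma one_sub_inner_ne_zero {x₀ a : C2} (hx : ‖x₀‖ < 1) (ha : ‖a‖ ≤ 1) : 1 - ⟪x₀, a⟫_ℂ ≠ 0 := by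
  intro h
  have h1 : ⟪x₀, a⟫_ℂ = 1 := (sub_eq_zero.1 h).symm
  have h2 := norm_inner_le_norm (𝕜 := ℂ) x₀ a
  rw [h1, norm_one] at h2
  nlinarith [norm_nonneg x₀, norm_nonneg a]

lemma form_homog_normalizedLift {x₀ a : C2} (hx : ‖x₀‖ < 1) (ha : ‖a‖ ≤ 1) :
    form (homog x₀) (normalizedLift x₀ a) = -1 := by
  have := one_sub_inner_ne_zero hx ha
  rw [normalizedLift, form_smul_right, form_homog]
  field_simp
  ring

lemma normalizedLift_neg {x₀ a : C2} (hx : ‖x₀‖ < 1) (ha : ‖a‖ < 1) :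
    (form (normalizedLift x₀ a) (normalizedLift x₀ a)).re < 0 := by
  have h0 := one_sub_inner_ne_zero hx ha.le
  have h1 : form (normalizedLift x₀ a) (normalizedLift x₀ a) =
      ((Complex.normSq (1 - ⟪x₀, a⟫_ℂ)⁻¹ * (‖a‖ ^ 2 - 1) : ℝ) : ℂ) := by
    rw [normalizedLift, form_smul_left, form_smul_right, form_homog_self, Complex.ofReal_mul,
      ← Complex.mul_conj]
    ring
  rw [h1, Complex.ofReal_re]
  have : 0 < Complex.normSq (1 - ⟪x₀, a⟫_ℂ)⁻¹ := Complex.normSq_pos.2 (inv_ne_zero h0)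
  have : ‖a‖ ^ 2 < 1 := by nlinarith [norm_nonneg a]
  nlinarith

lemma proj_normalizedLift {x₀ a : C2} (hx : ‖x₀‖ < 1) (ha : ‖a‖ ≤ 1) :
    proj (normalizedLift x₀ a) = a := by
  rw [normalizedLift, proj_smul (inv_ne_zero (one_sub_inner_ne_zero hx ha)), proj_homog]

lemma IsRPlane.norm_lt_one {S : Set C2} (hS : IsRPlane S) {a : C2} (ha : a ∈ S) : ‖a‖ < 1 := by
  simpa using hS.subset_ball ha

/-- The surface lies in the union of the geodesics through a point `x₀` tangent to the surface. -/
lemma IsRPlane.fderiv_eq_zero {S : Set C2} (hS : IsRPlane S) {x₀ a : C2} (hx : x₀ ∈ S)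
    (ha : a ∈ S) {U : Set C2} {F : C2 → ℝ × ℝ} (hU : IsOpen U) (hxU : x₀ ∈ U)
    (hF : ContDiffOn ℝ ∞ F U) (hSU : S ∩ U = {y ∈ U | F y = 0}) :
    fderiv ℝ F x₀ ((1 - ⟪x₀, a⟫_ℂ)⁻¹ • (a - x₀)) = 0 := by
  have hx1 := hS.norm_lt_one hx
  have ha1 := hS.norm_lt_one ha
  set κ := (1 - ⟪x₀, a⟫_ℂ)⁻¹ with hκ
  set A := normalizedLift x₀ a with hA
  have hXA : form (homog x₀) A = -1 := form_homog_normalizedLift hx1 ha1.le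
  have hX0 : (form (homog x₀) (homog x₀)).re < 0 := by
    rw [form_homog_self, Complex.ofReal_re]; nlinarith [norm_nonneg x₀]
  -- A reparametrized piece of the geodesic from `x₀` to `a`: the product `-1` of the two lifts is
  -- real, so `proj_mem` keeps `c r` in `S` for small `r` of either sign, and `F ∘ c` vanishes near
  -- `0`.
  set c : ℝ → C2 := fun r => proj (homog x₀ + (r : ℂ) • A) with hc
  have hcr (r : ℝ) : c r = (1 + (r : ℂ) * κ)⁻¹ • (x₀ + ((r : ℂ) * κ) • a) := by
    simp [hc, proj, homog, hA, normalizedLift, ← hκ, smul_smul]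
  have hlin : HasDerivAt (fun r : ℝ => (r : ℂ) * κ) κ 0 := by
    simpa using ((hasDerivAt_id (0 : ℝ)).ofReal_comp).mul_const κ
  have hder : HasDerivAt c (κ • (a - x₀)) 0 := by
    have h1 := (hlin.const_add 1).inv (by simp)
    have h2 := (hlin.smul_const a).const_add x₀
    have h3 := h1.smul h2
    rw [show c = _ from funext hcr]
    refine h3.congr_deriv ?_
    simp
    module
  have hc0 : c 0 = x₀ := by simp [hcr]
  have hFd : HasFDerivAt F (fderiv ℝ F x₀) (c 0) := by
    rw [hc0]
    exact ((hF.contDiffAt (hU.mem_nhds hxU)).differentiableAt (by simp)).hasFDerivAt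
  have hcomp := hFd.comp_hasDerivAt (0 : ℝ) hder
  have hev : ∀ᶠ r in 𝓝 (0 : ℝ), F (c r) = 0 := by
    have hmemU : ∀ᶠ r in 𝓝 (0 : ℝ), c r ∈ U :=
      hder.continuousAt.eventually_mem (hc0.symm ▸ hU.mem_nhds hxU)
    have hneg : ∀ᶠ r : ℝ in 𝓝 0,
        (form (homog x₀ + (r : ℂ) • A) (homog x₀ + (r : ℂ) • A)).re < 0 := by
      have hcont : Continuous fun r : ℝ =>
          (form (homog x₀ + (r : ℂ) • A) (homog x₀ + (r : ℂ) • A)).re := by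
        simp only [form_add_left, form_add_right, form_smul_left, form_smul_right,
          Complex.conj_ofReal]
        fun_prop
      exact hcont.continuousAt.eventually_lt continuousAt_const (by simpa using hX0)
    filter_upwards [hmemU, hneg] with r hrU hr
    have hmem : c r ∈ S := by
      have := hS.proj_mem (x := 1) (y := r) hX0 (normalizedLift_neg hx1 ha1)
        (by rw [← hA, hXA]; simp) (by rwa [proj_homog])
        (by rwa [proj_normalizedLift hx1 ha1.le]) (by simpa using hr)
      rwa [Complex.ofReal_one, one_smul] at this
    have : c r ∈ {y ∈ U | F y = 0} := hSU ▸ ⟨hmem, hrU⟩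
    exact this.2
  have hzero : HasDerivAt (F ∘ c) 0 0 :=
    (hasDerivAt_const (0 : ℝ) (0 : ℝ × ℝ)).congr_of_eventuallyEq hev
  exact hcomp.unique hzero

/-- The normalized representatives of the points of the surface have real products. -/
lemma IsRPlane.form_im_eq_zero {S : Set C2} (hS : IsRPlane S) {x₀ a b : C2} (hx : x₀ ∈ S)
    (ha : a ∈ S) (hb : b ∈ S) : (form (normalizedLift x₀ a) (normalizedLift x₀ b)).im = 0 := by
  by_contra him
  obtain ⟨U, F, hU, hxU, hF, hSU, -, htr⟩ := hS.totallyReal x₀ hx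
  have htr' := htr x₀ ⟨hx, hxU⟩
  have hx1 := hS.norm_lt_one hx
  have ha1 := hS.norm_lt_one ha
  have hb1 := hS.norm_lt_one hb
  set A := normalizedLift x₀ a with hA
  set B := normalizedLift x₀ b with hB
  have hXA : form (homog x₀) A = -1 := form_homog_normalizedLift hx1 ha1.le
  have hXB : form (homog x₀) B = -1 := form_homog_normalizedLift hx1 hb1.le
  have hAA := normalizedLift_neg hx1 ha1
  have hBB := normalizedLift_neg hx1 hb1
  rw [← hA] at hAA
  rw [← hB] at hBB
  set k := form A B with hk
  have hk0 : k ≠ 0 := by rintro h; rw [h] at him; simp at him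
  have hkn : (‖k‖ : ℂ) ≠ 0 := by simpa using hk0
  have hkp : 0 < ‖k‖ := norm_pos_iff.2 hk0
  -- Rotating `B` by `u` makes its product with `A` the negative real number `-‖k‖`, so `A + u • B`
  -- represents a point `y` of the geodesic through `a` and `b`. If `k` is not real, neither is `u`.
  set u : ℂ := -(conj k / ‖k‖) with hu
  have huk : u * k = -(‖k‖ : ℂ) := by
    rw [hu]; field_simp; rw [Complex.conj_mul']
  have huim : u.im ≠ 0 := by
    rw [hu, Complex.neg_im, Complex.div_ofReal_im, Complex.conj_im]
    simpa [hk0] using him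
  have hu0 : u ≠ 0 := by rintro h; simp [h] at huim
  have huu : conj u * u = 1 := by
    rw [hu, map_neg, map_div₀, Complex.conj_conj, Complex.conj_ofReal]
    field_simp; rw [Complex.mul_conj']
  set Z : C2 × ℂ := A + u • B with hZ
  have hZneg : (form Z Z).re < 0 := by
    have hBA : form B A = conj k := by rw [hk, form_conj]
    have huk' : conj u * conj k = -(‖k‖ : ℂ) := by
      rw [← map_mul, huk, map_neg, Complex.conj_ofReal]
    have : form Z Z = form A A + form B B - 2 * (‖k‖ : ℂ) := by
      simp only [hZ, form_add_left, form_add_right, form_smul_left, form_smul_right, hBA, ← hk]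
      linear_combination huk + huk' + form B B * huu
    rw [this]
    simp only [Complex.sub_re, Complex.add_re, Complex.mul_re, Complex.ofReal_re, Complex.re_ofNat,
      Complex.ofReal_im]
    linarith
  have hZ2 := snd_ne_zero_of_neg hZneg
  have huB : (form (u • B) (u • B)).re < 0 := by
    rw [form_smul_left, form_smul_right, ← mul_assoc, huu, one_mul]; exact hBB
  have hy : proj Z ∈ S := by
    have := hS.proj_mem (x := 1) (y := 1) hAA huB
      (by rw [form_smul_right, ← hk, huk]; simp) (by rwa [hA, proj_normalizedLift hx1 ha1.le])
      (by rwa [proj_smul hu0, hB, proj_normalizedLift hx1 hb1.le]) (by simpa using hZneg)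
    simpa using this
  set y := proj Z with hyd
  set D := fderiv ℝ F x₀ with hD
  -- `φ X` is the velocity at `x₀` of `r ↦ proj (homog x₀ + r • X)`, so the three vanishing
  -- statements below say that the directions from `x₀` to `a`, `b` and `y` are tangent to `S`.
  set φ : C2 × ℂ → C2 := fun X => X.1 - X.2 • x₀ with hφ
  have hφl (s : C2) : (1 - ⟪x₀, s⟫_ℂ)⁻¹ • (s - x₀) = φ (normalizedLift x₀ s) := by
    simp [hφ, normalizedLift, homog, smul_sub]
  have hDa : D (φ A) = 0 := by
    rw [hA, ← hφl]; exact hS.fderiv_eq_zero hx ha hU hxU hF hSU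
  have hDb : D (φ B) = 0 := by
    rw [hB, ← hφl]; exact hS.fderiv_eq_zero hx hb hU hxU hF hSU
  have hDy : D (φ (normalizedLift x₀ y)) = 0 := by
    rw [← hφl]; exact hS.fderiv_eq_zero hx hy hU hxU hF hSU
  have h1u : 1 + u ≠ 0 := by
    intro h
    have := congrArg Complex.im h
    simp at this; exact huim this
  have hly : normalizedLift x₀ y = (1 + u)⁻¹ • Z := by
    have hXZ : form (homog x₀) Z = -(1 + u) := by
      rw [hZ, form_add_right, form_smul_right, hXA, hXB]; ring
    have hXh : 1 - ⟪x₀, y⟫_ℂ = Z.2⁻¹ * (1 + u) := by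
      have : form (homog x₀) (homog y) = Z.2⁻¹ * -(1 + u) := by
        rw [hyd, homog_proj hZ2, form_smul_right, hXZ]
      rw [form_homog] at this
      linear_combination -this
    rw [normalizedLift, hXh, hyd, homog_proj hZ2, smul_smul]
    congr 1
    field_simp
  set d := φ A - φ B with hd
  have hDd : D d = 0 := by rw [hd, map_sub, hDa, hDb, sub_zero]
  set κ := (1 + u)⁻¹ with hκ
  -- The normalized lift of `y` is an affine combination of `A` and `B` with the nonreal coefficient
  -- `κ`. Hence `κ • d` is tangent along with `d`, and so is `I • d`; total reality then gives `d =
  -- 0`.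
  have hκd : φ (normalizedLift x₀ y) = φ B + κ • d := by
    rw [hly, hd]
    have : φ (κ • Z) = κ • φ A + (κ * u) • φ B := by
      simp only [hφ, hZ, Prod.smul_fst, Prod.fst_add, Prod.smul_snd, Prod.snd_add, smul_eq_mul]
      module
    rw [this]
    have h2 : κ * u = 1 - κ := by rw [hκ]; field_simp; ring
    rw [h2]; module
  have hDκ : D (κ • d) = 0 := by
    have := hDy
    rwa [hκd, map_add, hDb, zero_add] at this
  have hsplit : κ • d = κ.re • d + κ.im • (Complex.I • d) := by
    have h : κ = (κ.re : ℂ) + (κ.im : ℂ) * Complex.I := (Complex.re_add_im κ).symm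
    conv_lhs => rw [h]
    rw [add_smul, mul_smul, Complex.coe_smul, Complex.coe_smul]
  have hκim : κ.im ≠ 0 := by
    rw [hκ, Complex.inv_im]
    have : Complex.normSq (1 + u) ≠ 0 := by simpa using h1u
    simp [huim, this]
  have hDI : D (Complex.I • d) = 0 := by
    rw [hsplit, map_add, map_smul, map_smul, hDd, smul_zero, zero_add] at hDκ
    exact (smul_eq_zero.1 hDκ).resolve_left hκim
  have hd0 : d = 0 := htr' d hDd hDI
  -- the normalized representatives coincide
  have hAB1 : (A - B).1 = (A - B).2 • x₀ := by
    have : (A - B).1 - (A - B).2 • x₀ = d := by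
      simp only [hd, hφ, Prod.fst_sub, Prod.snd_sub]; module
    rw [← sub_eq_zero, this, hd0]
  have hfz : form (homog x₀) (A - B) = 0 := by rw [form_sub_right, hXA, hXB, sub_self]
  have h2 : (A - B).2 = 0 := by
    have hAB' : A - B = (A - B).2 • homog x₀ := by
      ext1
      · rw [hAB1]; simp [homog]
      · simp [homog]
    rw [hAB', form_smul_right, form_homog_self] at hfz
    refine (mul_eq_zero.1 hfz).resolve_right ?_
    have : ‖x₀‖ ^ 2 - 1 ≠ 0 := by nlinarith [norm_nonneg x₀]
    exact_mod_cast this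
  -- With equal lifts, `k = form A A` is real, against the assumption.
  have hABeq : A = B := by
    rw [← sub_eq_zero]
    exact Prod.ext (by rw [hAB1, h2, zero_smul]; rfl) h2
  rw [hk, ← hABeq, form_self_eq_re, Complex.ofReal_im] at him
  exact him rfl

/-- The triple product whose argument is the Cartan angular invariant. -/
def cartan (x y z : C2) : ℂ :=
  form (homog x) (homog y) * form (homog y) (homog z) * form (homog z) (homog x)

/-- A limit argument. With the base point `x₀` in the open ball, `1 - ⟪x₀, s⟫` has no zero on the
closed ball, so the normalized lift stays continuous up to the boundary. -/
lemma im_form_eq_zero_of_mem_closure {S : Set C2} (hS : IsRPlane S) {x₀ a b : C2} (hx : x₀ ∈ S)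
    (ha : a ∈ closure S) (hb : b ∈ closure S) :
    (form (normalizedLift x₀ a) (normalizedLift x₀ b)).im = 0 := by
  have hx1 := hS.norm_lt_one hx
  have hcl : closure S ⊆ Metric.closedBall 0 1 :=
    (closure_mono hS.subset_ball).trans Metric.closure_ball_subset_closedBall
  have hne {s : C2} (hs : s ∈ closure S) : 1 - ⟪x₀, s⟫_ℂ ≠ 0 :=
    one_sub_inner_ne_zero hx1 (by simpa using hcl hs)
  obtain ⟨f, hf, hfa⟩ := mem_closure_iff_seq_limit.1 ha
  obtain ⟨g, hg, hgb⟩ := mem_closure_iff_seq_limit.1 hb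
  have hl {s : C2} (hs : s ∈ closure S) : ContinuousAt (fun y => normalizedLift x₀ y) s := by
    unfold normalizedLift homog
    have : ContinuousAt (fun y : C2 => 1 - ⟪x₀, y⟫_ℂ) s := by fun_prop
    exact (this.inv₀ (hne hs)).smul (by fun_prop)
  have hform : Continuous fun p : (C2 × ℂ) × (C2 × ℂ) => (form p.1 p.2).im := by
    unfold form; fun_prop
  have ht := (hform.tendsto _).comp
    (((hl ha).tendsto.comp hfa).prodMk_nhds ((hl hb).tendsto.comp hgb))
  refine tendsto_nhds_unique ht ?_
  refine tendsto_const_nhds.congr fun n => ?_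
  exact (hS.form_im_eq_zero hx (hf n) (hg n)).symm

/-- The Cartan angular invariant of points of an `ℝ`-circle vanishes. -/
lemma IsRCircle.cartan_im {K : Set ExtHeis} (hK : IsRCircle K) {p q r : ExtHeis} (hp : p ∈ K)
    (hq : q ∈ K) (hr : r ∈ K) : (cartan (toSphere p) (toSphere q) (toSphere r)).im = 0 := by
  obtain ⟨S, hS, hKS⟩ := hK
  obtain ⟨x₀, hx⟩ := hS.nonempty
  have hx1 := hS.norm_lt_one hx
  have hmem {s : ExtHeis} (hs : s ∈ K) : toSphere s ∈ closure S :=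
    (hKS ▸ mem_image_of_mem toSphere hs : toSphere s ∈ closure S ∩ Metric.sphere 0 1).1
  -- In the cyclic triple product each factor `1 - ⟪x₀, ·⟫` meets its own conjugate, which leaves a
  -- real number.
  have hform (a b : C2) (ha : 1 - ⟪x₀, a⟫_ℂ ≠ 0) (hb : 1 - ⟪x₀, b⟫_ℂ ≠ 0)
      (h : (form (normalizedLift x₀ a) (normalizedLift x₀ b)).im = 0) :
      ∃ ρ : ℝ, form (homog a) (homog b) = conj (1 - ⟪x₀, a⟫_ℂ) * (1 - ⟪x₀, b⟫_ℂ) * (ρ : ℂ) := by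
    refine ⟨(form (normalizedLift x₀ a) (normalizedLift x₀ b)).re, ?_⟩
    have e : ((form (normalizedLift x₀ a) (normalizedLift x₀ b)).re : ℂ) =
      form (normalizedLift x₀ a) (normalizedLift x₀ b) := Complex.ext (by simp) (by simp [h])
    have ha' : conj (1 - ⟪x₀, a⟫_ℂ) ≠ 0 := (map_ne_zero _).2 ha
    rw [e, normalizedLift, normalizedLift, form_smul_left, form_smul_right, map_inv₀]
    field_simp
  have hne (s : ExtHeis) : 1 - ⟪x₀, toSphere s⟫_ℂ ≠ 0 :=
    one_sub_inner_ne_zero hx1 (norm_toSphere s).le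
  obtain ⟨ρ₁, h₁⟩ := hform _ _ (hne p) (hne q)
    (im_form_eq_zero_of_mem_closure hS hx (hmem hp) (hmem hq))
  obtain ⟨ρ₂, h₂⟩ := hform _ _ (hne q) (hne r)
    (im_form_eq_zero_of_mem_closure hS hx (hmem hq) (hmem hr))
  obtain ⟨ρ₃, h₃⟩ := hform _ _ (hne r) (hne p)
    (im_form_eq_zero_of_mem_closure hS hx (hmem hr) (hmem hp))
  have : cartan (toSphere p) (toSphere q) (toSphere r) =
      ((Complex.normSq (1 - ⟪x₀, toSphere p⟫_ℂ) * Complex.normSq (1 - ⟪x₀, toSphere q⟫_ℂ) *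
        Complex.normSq (1 - ⟪x₀, toSphere r⟫_ℂ) * (ρ₁ * ρ₂ * ρ₃) : ℝ) : ℂ) := by
    rw [cartan, h₁, h₂, h₃]
    push_cast [← Complex.mul_conj]
    ring
  rw [this, Complex.ofReal_im]

/-! ### Orthonormal frames and the `ℝ`-planes and `ℝ`-circles they span -/

/-- An orthonormal basis of `ℂ² × ℂ` for the form of signature `(2, 1)`. -/
structure IsFrame (e₁ e₂ e₃ : C2 × ℂ) : Prop where
  h11 : form e₁ e₁ = 1
  h22 : form e₂ e₂ = 1
  h33 : form e₃ e₃ = -1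
  h12 : form e₁ e₂ = 0
  h13 : form e₁ e₃ = 0
  h23 : form e₂ e₃ = 0

/-- The affine coordinate of a point of `ℂ²` along `e` in a frame with negative vector `e₃`. -/
def coord (e e₃ : C2 × ℂ) (y : C2) : ℂ := -(form e (homog y) / form e₃ (homog y))

/-- The real vector with coordinates `(a, b, 1)` in a frame. -/
def realVec (e₁ e₂ e₃ : C2 × ℂ) (a b : ℝ) : C2 × ℂ := (a : ℂ) • e₁ + (b : ℂ) • e₂ + e₃

namespace IsFrame

variable {e₁ e₂ e₃ : C2 × ℂ}

lemma h21 (h : IsFrame e₁ e₂ e₃) : form e₂ e₁ = 0 := by rw [← form_conj, h.h12, map_zero]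

lemma h31 (h : IsFrame e₁ e₂ e₃) : form e₃ e₁ = 0 := by rw [← form_conj, h.h13, map_zero]

lemma h32 (h : IsFrame e₁ e₂ e₃) : form e₃ e₂ = 0 := by rw [← form_conj, h.h23, map_zero]

lemma linearIndependent (h : IsFrame e₁ e₂ e₃) : LinearIndependent ℂ ![e₁, e₂, e₃] := by
  rw [Fintype.linearIndependent_iff]
  intro g hg
  simp only [Fin.sum_univ_three, Matrix.cons_val_zero, Matrix.cons_val_one, Matrix.cons_val] at hg
  have h0 (X : C2 × ℂ) : form X 0 = 0 := by simp [form]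
  have g0 : g 0 = 0 := by
    have := congrArg (form e₁) hg
    simpa [form_add_right, form_smul_right, h.h11, h.h12, h.h13, h0] using this
  have g1 : g 1 = 0 := by
    have := congrArg (form e₂) hg
    simpa [form_add_right, form_smul_right, h.h21, h.h22, h.h23, h0] using this
  have g2 : g 2 = 0 := by
    have := congrArg (form e₃) hg
    simpa [form_add_right, form_smul_right, h.h31, h.h32, h.h33, h0] using this
  intro i
  fin_cases i
  exacts [g0, g1, g2]

lemma expand (h : IsFrame e₁ e₂ e₃) (X : C2 × ℂ) :
    X = form e₁ X • e₁ + form e₂ X • e₂ - form e₃ X • e₃ := by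
  have hspan : Submodule.span ℂ (range ![e₁, e₂, e₃]) = ⊤ :=
    h.linearIndependent.span_eq_top_of_card_eq_finrank' (by simp)
  have hX : X ∈ Submodule.span ℂ (range ![e₁, e₂, e₃]) := hspan ▸ Submodule.mem_top
  rw [Submodule.mem_span_range_iff_exists_fun] at hX
  obtain ⟨g, hg⟩ := hX
  simp only [Fin.sum_univ_three, Matrix.cons_val_zero, Matrix.cons_val_one, Matrix.cons_val] at hg
  rw [← hg]
  simp only [form_add_right, form_smul_right, h.h11, h.h12, h.h13, h.h21, h.h22, h.h23, h.h31,
    h.h32, h.h33]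
  module

lemma form_eq (h : IsFrame e₁ e₂ e₃) (X Y : C2 × ℂ) :
    form X Y = conj (form e₁ X) * form e₁ Y + conj (form e₂ X) * form e₂ Y -
      conj (form e₃ X) * form e₃ Y := by
  conv_lhs => rw [h.expand X]
  simp only [form_add_left, form_sub_left, form_smul_left]

lemma form_self_eq (h : IsFrame e₁ e₂ e₃) (X : C2 × ℂ) :
    (form X X).re = Complex.normSq (form e₁ X) + Complex.normSq (form e₂ X) -
      Complex.normSq (form e₃ X) := by
  rw [h.form_eq X X]
  simp only [mul_comm (conj _), Complex.mul_conj]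
  simp

lemma form_ne_zero (h : IsFrame e₁ e₂ e₃) {X : C2 × ℂ} (hX : (form X X).re ≤ 0) (hX0 : X ≠ 0) :
    form e₃ X ≠ 0 := by
  intro h3
  rw [h.form_self_eq, h3, map_zero, sub_zero] at hX
  have n1 := Complex.normSq_nonneg (form e₁ X)
  have n2 := Complex.normSq_nonneg (form e₂ X)
  have h1 : form e₁ X = 0 := Complex.normSq_eq_zero.1 (by linarith)
  have h2 : form e₂ X = 0 := Complex.normSq_eq_zero.1 (by linarith)
  apply hX0
  rw [h.expand X, h1, h2, h3]
  simp

lemma form_homog_ne_zero (h : IsFrame e₁ e₂ e₃) {y : C2} (hy : ‖y‖ ≤ 1) :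
    form e₃ (homog y) ≠ 0 := by
  apply h.form_ne_zero
  · rw [form_homog_self, Complex.ofReal_re]; nlinarith [norm_nonneg y]
  · intro h0
    have := congrArg Prod.snd h0
    simp [homog] at this

lemma form_realVec₁ (h : IsFrame e₁ e₂ e₃) (a b : ℝ) : form e₁ (realVec e₁ e₂ e₃ a b) = a := by
  rw [realVec, form_add_right, form_add_right, form_smul_right, form_smul_right, h.h11, h.h12, h.h13]
  simp

lemma form_realVec₂ (h : IsFrame e₁ e₂ e₃) (a b : ℝ) : form e₂ (realVec e₁ e₂ e₃ a b) = b := by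
  rw [realVec, form_add_right, form_add_right, form_smul_right, form_smul_right, h.h21, h.h22, h.h23]
  simp

lemma form_realVec₃ (h : IsFrame e₁ e₂ e₃) (a b : ℝ) : form e₃ (realVec e₁ e₂ e₃ a b) = -1 := by
  rw [realVec, form_add_right, form_add_right, form_smul_right, form_smul_right, h.h31, h.h32, h.h33]
  simp

lemma form_realVec (h : IsFrame e₁ e₂ e₃) (a b c d : ℝ) :
    form (realVec e₁ e₂ e₃ a b) (realVec e₁ e₂ e₃ c d) = ((a * c + b * d - 1 : ℝ) : ℂ) := by
  rw [h.form_eq]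
  simp [h.form_realVec₁, h.form_realVec₂, h.form_realVec₃]

lemma realVec_ne_zero (h : IsFrame e₁ e₂ e₃) (a b : ℝ) : realVec e₁ e₂ e₃ a b ≠ 0 := by
  intro h0
  have := h.form_realVec₃ a b
  rw [h0] at this
  simp [form] at this

lemma realVec_snd_ne_zero (h : IsFrame e₁ e₂ e₃) {a b : ℝ} (hab : a ^ 2 + b ^ 2 ≤ 1) :
    (realVec e₁ e₂ e₃ a b).2 ≠ 0 := by
  apply snd_ne_zero_of_nonpos _ (h.realVec_ne_zero a b)
  rw [h.form_realVec, Complex.ofReal_re]; nlinarith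

lemma norm_proj_realVec_lt (h : IsFrame e₁ e₂ e₃) {a b : ℝ} (hab : a ^ 2 + b ^ 2 < 1) :
    ‖proj (realVec e₁ e₂ e₃ a b)‖ < 1 := by
  apply norm_proj_lt_one
  rw [h.form_realVec, Complex.ofReal_re]; nlinarith

lemma norm_proj_realVec_eq (h : IsFrame e₁ e₂ e₃) {a b : ℝ} (hab : a ^ 2 + b ^ 2 = 1) :
    ‖proj (realVec e₁ e₂ e₃ a b)‖ = 1 := by
  apply norm_proj_eq_one _ (h.realVec_snd_ne_zero hab.le)
  rw [h.form_realVec]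
  norm_cast
  nlinarith

end IsFrame

lemma coord_proj {e e₃ Z : C2 × ℂ} (hZ : Z.2 ≠ 0) :
    coord e e₃ (proj Z) = -(form e Z / form e₃ Z) := by
  rw [coord, homog_proj hZ, form_smul_right, form_smul_right, mul_div_mul_left _ _ (inv_ne_zero hZ)]

namespace IsFrame

variable {e₁ e₂ e₃ : C2 × ℂ}

lemma coord_realVec₁ (h : IsFrame e₁ e₂ e₃) {a b : ℝ} (hab : a ^ 2 + b ^ 2 ≤ 1) :
    coord e₁ e₃ (proj (realVec e₁ e₂ e₃ a b)) = a := by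
  rw [coord_proj (h.realVec_snd_ne_zero hab), h.form_realVec₁, h.form_realVec₃, div_neg, div_one, neg_neg]

lemma coord_realVec₂ (h : IsFrame e₁ e₂ e₃) {a b : ℝ} (hab : a ^ 2 + b ^ 2 ≤ 1) :
    coord e₂ e₃ (proj (realVec e₁ e₂ e₃ a b)) = b := by
  rw [coord_proj (h.realVec_snd_ne_zero hab), h.form_realVec₂, h.form_realVec₃, div_neg, div_one, neg_neg]

/-- A point of the closed ball is recovered from its affine coordinates. -/
lemma eq_proj_realVec (h : IsFrame e₁ e₂ e₃) {y : C2} (hy : ‖y‖ ≤ 1)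
    (h1 : (coord e₁ e₃ y).im = 0) (h2 : (coord e₂ e₃ y).im = 0) :
    y = proj (realVec e₁ e₂ e₃ (coord e₁ e₃ y).re (coord e₂ e₃ y).re) := by
  have h3 := h.form_homog_ne_zero hy
  have e1 : ((coord e₁ e₃ y).re : ℂ) = coord e₁ e₃ y := Complex.ext (by simp) (by simp [h1])
  have e2 : ((coord e₂ e₃ y).re : ℂ) = coord e₂ e₃ y := Complex.ext (by simp) (by simp [h2])
  -- The real vector is the lift of `y` rescaled so that its coefficient along `e₃` is `1`.
  have : realVec e₁ e₂ e₃ (coord e₁ e₃ y).re (coord e₂ e₃ y).re =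
      (-(form e₃ (homog y))⁻¹) • homog y := by
    have h4 := h.expand (homog y)
    rw [realVec, e1, e2, coord, coord]
    generalize form e₁ (homog y) = x₁ at *
    generalize form e₂ (homog y) = x₂ at *
    generalize form e₃ (homog y) = x₃ at *
    rw [h4]
    simp only [smul_add, smul_sub, smul_smul, neg_smul, neg_mul, inv_mul_cancel₀ h3, div_eq_inv_mul]
    module
  rw [this, proj_smul (neg_ne_zero.2 (inv_ne_zero h3)), proj_homog]

lemma form_homog_self_coord (h : IsFrame e₁ e₂ e₃) {y : C2} (hy : ‖y‖ ≤ 1)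
    (h1 : (coord e₁ e₃ y).im = 0) (h2 : (coord e₂ e₃ y).im = 0) :
    ‖y‖ ^ 2 - 1 = Complex.normSq (form e₃ (homog y)) *
      ((coord e₁ e₃ y).re ^ 2 + (coord e₂ e₃ y).re ^ 2 - 1) := by
  have h3 := h.form_homog_ne_zero hy
  have h3n : Complex.normSq (form e₃ (homog y)) ≠ 0 := by simpa using h3
  have key := h.form_self_eq (homog y)
  rw [form_homog_self, Complex.ofReal_re] at key
  have e (z : ℂ) (hz : z.im = 0) : z.re ^ 2 = Complex.normSq z := by
    rw [Complex.normSq_apply, hz]; ring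
  rw [key, e _ h1, e _ h2, coord, coord, Complex.normSq_neg, Complex.normSq_neg,
    Complex.normSq_div, Complex.normSq_div]
  field_simp

lemma coord_sq_lt_one (h : IsFrame e₁ e₂ e₃) {y : C2} (hy : ‖y‖ < 1)
    (h1 : (coord e₁ e₃ y).im = 0) (h2 : (coord e₂ e₃ y).im = 0) :
    (coord e₁ e₃ y).re ^ 2 + (coord e₂ e₃ y).re ^ 2 < 1 := by
  have key := h.form_homog_self_coord hy.le h1 h2
  have h3 : 0 < Complex.normSq (form e₃ (homog y)) :=
    Complex.normSq_pos.2 (h.form_homog_ne_zero hy.le)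
  by_contra hcon
  push Not at hcon
  have := mul_nonneg h3.le (sub_nonneg.2 hcon)
  nlinarith [norm_nonneg y]

lemma coord_sq_eq_one (h : IsFrame e₁ e₂ e₃) {y : C2} (hy : ‖y‖ = 1)
    (h1 : (coord e₁ e₃ y).im = 0) (h2 : (coord e₂ e₃ y).im = 0) :
    (coord e₁ e₃ y).re ^ 2 + (coord e₂ e₃ y).re ^ 2 = 1 := by
  have key := h.form_homog_self_coord hy.le h1 h2
  have h3 : Complex.normSq (form e₃ (homog y)) ≠ 0 := by
    simpa using h.form_homog_ne_zero hy.le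
  rw [hy] at key
  have : Complex.normSq (form e₃ (homog y)) *
    ((coord e₁ e₃ y).re ^ 2 + (coord e₂ e₃ y).re ^ 2 - 1) = 0 := by rw [← key]; norm_num
  linarith [(mul_eq_zero.1 this).resolve_left h3]

/-- The derivative of an affine coordinate. -/
lemma hasFDerivAt_coord (h : IsFrame e₁ e₂ e₃) (e : C2 × ℂ) {y : C2} (hy : ‖y‖ ≤ 1) :
    ∃ D : C2 →L[ℂ] ℂ, HasFDerivAt (coord e e₃) D y ∧
      ∀ v, D v = -((form e (v, 0) * form e₃ (homog y) - form e (homog y) * form e₃ (v, 0)) /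
        form e₃ (homog y) ^ 2) := by
  have h3 := h.form_homog_ne_zero hy
  have hl (f : C2 × ℂ) : HasFDerivAt (fun z : C2 => form f (homog z)) (innerSL ℂ f.1) y := by
    have := ((innerSL ℂ f.1).hasFDerivAt (x := y)).sub_const (conj f.2)
    refine this.congr_of_eventuallyEq (Filter.Eventually.of_forall fun z => ?_)
    simp [form, homog]
  have hinv := (hasDerivAt_inv h3).comp_hasFDerivAt y (hl e₃)
  have hmul := ((hl e).mul hinv).neg
  refine ⟨_, hmul.congr_of_eventuallyEq (Filter.Eventually.of_forall fun z => ?_), fun v => ?_⟩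
  · simp [coord, div_eq_mul_inv]
  · have hv (f : C2 × ℂ) : form f (v, 0) = ⟪f.1, v⟫_ℂ := by simp [form]
    rw [hv, hv]
    simp only [neg_apply, add_apply,
      smul_apply, smul_eq_mul, innerSL_apply_apply, Function.comp]
    field_simp
    ring

lemma contDiffAt_coord (h : IsFrame e₁ e₂ e₃) (e : C2 × ℂ) {y : C2} (hy : ‖y‖ ≤ 1) :
    ContDiffAt ℝ ∞ (coord e e₃) y := by
  have hl (f : C2 × ℂ) : ContDiff ℝ ∞ fun z : C2 => form f (homog z) := by
    have : (fun z : C2 => form f (homog z)) = fun z => ⟪f.1, z⟫_ℂ - conj f.2 := by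
      ext z; simp [form, homog]
    rw [this]
    exact (((innerSL ℂ f.1).restrictScalars ℝ).contDiff).sub contDiff_const
  have := ((hl e).contDiffAt.mul ((hl e₃).contDiffAt.inv (h.form_homog_ne_zero hy))).neg
  refine this.congr_of_eventuallyEq (Filter.Eventually.of_forall fun z => ?_)
  simp [coord, div_eq_mul_inv]

end IsFrame

/-- The `ℝ`-plane of a frame. -/
def realPlane (e₁ e₂ e₃ : C2 × ℂ) : Set C2 :=
  {y | ‖y‖ < 1 ∧ (coord e₁ e₃ y).im = 0 ∧ (coord e₂ e₃ y).im = 0}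

/-- The `ℝ`-circle of a frame, as a subset of the sphere. -/
def realCircle (e₁ e₂ e₃ : C2 × ℂ) : Set C2 :=
  {y | ‖y‖ = 1 ∧ (coord e₁ e₃ y).im = 0 ∧ (coord e₂ e₃ y).im = 0}

namespace IsFrame

variable {e₁ e₂ e₃ : C2 × ℂ}

/-- The two affine coordinates have a jointly injective complex derivative, and the surface is where
both are real. A vector `v` with `v` and `I • v` both tangent has real and purely imaginary
coordinate derivatives at once, hence vanishes. -/
lemma isTotallyRealSurface (h : IsFrame e₁ e₂ e₃) :
    IsTotallyRealSurface (realPlane e₁ e₂ e₃) := by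
  intro x hx
  have hD (y : C2) (hy : ‖y‖ ≤ 1) : ∃ D₁ D₂ : C2 →L[ℂ] ℂ,
      HasFDerivAt (fun z => ((coord e₁ e₃ z).im, (coord e₂ e₃ z).im))
        ((Complex.imCLM.comp (D₁.restrictScalars ℝ)).prod
          (Complex.imCLM.comp (D₂.restrictScalars ℝ))) y ∧
      ∀ v, D₁ v = 0 → D₂ v = 0 → v = 0 := by
    obtain ⟨D₁, hD₁, hv₁⟩ := h.hasFDerivAt_coord e₁ hy
    obtain ⟨D₂, hD₂, hv₂⟩ := h.hasFDerivAt_coord e₂ hy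
    refine ⟨D₁, D₂, ?_, fun v h1 h2 => ?_⟩
    · exact (Complex.imCLM.hasFDerivAt.comp y (hD₁.restrictScalars ℝ)).prodMk
        (Complex.imCLM.hasFDerivAt.comp y (hD₂.restrictScalars ℝ))
    · have h3 := h.form_homog_ne_zero hy
      rw [hv₁, neg_eq_zero, div_eq_zero_iff, or_iff_left (pow_ne_zero 2 h3), sub_eq_zero] at h1
      rw [hv₂, neg_eq_zero, div_eq_zero_iff, or_iff_left (pow_ne_zero 2 h3), sub_eq_zero] at h2
      set k := form e₃ (v, 0) / form e₃ (homog y) with hk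
      -- If both coordinate derivatives vanish, `(v, 0)` is proportional to `homog y`, whose last
      -- entry is `1`; so the factor is `0`.
      have hvk : ((v, 0) : C2 × ℂ) = k • homog y := by
        conv_rhs => rw [h.expand (homog y)]
        rw [h.expand (v, 0)]
        simp only [smul_add, smul_sub, smul_smul]
        have a1 : form e₁ (v, 0) = k * form e₁ (homog y) := by rw [hk]; field_simp; rw [h1]; ring
        have a2 : form e₂ (v, 0) = k * form e₂ (homog y) := by rw [hk]; field_simp; rw [h2]; ring
        have a3 : form e₃ (v, 0) = k * form e₃ (homog y) := by rw [hk]; field_simp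
        rw [a1, a2, a3]
      have hk0 : k = 0 := by
        have := congrArg Prod.snd hvk
        simpa [homog] using this.symm
      have := congrArg Prod.fst hvk
      simpa [hk0] using this
  have hball {y : C2} (hy : y ∈ realPlane e₁ e₂ e₃ ∩ Metric.ball 0 1) : ‖y‖ ≤ 1 := hy.1.1.le
  refine ⟨Metric.ball 0 1, fun z => ((coord e₁ e₃ z).im, (coord e₂ e₃ z).im), Metric.isOpen_ball,
    by simpa using hx.1, ?_, ?_, fun y hy => ?_, fun y hy v => ?_⟩
  · have hc (e : C2 × ℂ) : ContDiffOn ℝ ∞ (coord e e₃) (Metric.ball 0 1) := fun z hz =>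
      (h.contDiffAt_coord e (mem_ball_zero_iff.1 hz).le).contDiffWithinAt
    exact (Complex.imCLM.contDiff.comp_contDiffOn (hc e₁)).prodMk
      (Complex.imCLM.contDiff.comp_contDiffOn (hc e₂))
  · ext y
    simp [realPlane, Prod.ext_iff]
    tauto
  · obtain ⟨D₁, D₂, hF, hinj⟩ := hD y (hball hy)
    rw [hF.fderiv]
    have hi : Function.Injective ((D₁.prod D₂ : C2 →L[ℂ] ℂ × ℂ) : C2 →ₗ[ℂ] ℂ × ℂ) := by
      rw [← LinearMap.ker_eq_bot, LinearMap.ker_eq_bot']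
      intro v hv
      simp only [ContinuousLinearMap.coe_coe, ContinuousLinearMap.prod_apply, Prod.mk_eq_zero] at hv
      exact hinj v hv.1 hv.2
    have hs : Function.Surjective ((D₁.prod D₂ : C2 →L[ℂ] ℂ × ℂ) : C2 →ₗ[ℂ] ℂ × ℂ) :=
      (LinearMap.injective_iff_surjective_of_finrank_eq_finrank (by simp)).1 hi
    rintro ⟨a, b⟩
    obtain ⟨v, hv⟩ := hs (a * Complex.I, b * Complex.I)
    refine ⟨v, ?_⟩
    have hv1 : D₁ v = a * Complex.I := congrArg Prod.fst hv
    have hv2 : D₂ v = b * Complex.I := congrArg Prod.snd hv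
    simp [hv1, hv2]
  · obtain ⟨D₁, D₂, hF, hinj⟩ := hD y (hball hy)
    rw [hF.fderiv]
    intro h1 h2
    simp only [ContinuousLinearMap.prod_apply, ContinuousLinearMap.comp_apply,
      ContinuousLinearMap.coe_restrictScalars', Prod.mk_eq_zero, Complex.imCLM_apply,
      map_smul, smul_eq_mul, Complex.I_mul_im] at h1 h2
    exact hinj v (Complex.ext h2.1 h1.1) (Complex.ext h2.2 h1.2)

/-- Real vectors of the frame have real products, so by `exists_combination` a geodesic through two
points of the plane consists of real combinations of their lifts, whose affine coordinates are real.
-/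
theorem isRPlane (h : IsFrame e₁ e₂ e₃) : IsRPlane (realPlane e₁ e₂ e₃) where
  nonempty := by
    refine ⟨proj (realVec e₁ e₂ e₃ 0 0), h.norm_proj_realVec_lt (by norm_num), ?_, ?_⟩
    · rw [h.coord_realVec₁ (by norm_num)]; simp
    · rw [h.coord_realVec₂ (by norm_num)]; simp
  subset_ball := fun y hy => by simpa using hy.1
  totallyReal := h.isTotallyRealSurface
  totallyGeodesic := by
    rintro c hc s t hst ⟨hs, hs1, hs2⟩ ⟨ht, ht1, ht2⟩ _ ⟨r, rfl⟩
    have es := h.eq_proj_realVec hs.le hs1 hs2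
    have et := h.eq_proj_realVec ht.le ht1 ht2
    have ns := h.coord_sq_lt_one hs hs1 hs2
    have nt := h.coord_sq_lt_one ht ht1 ht2
    set a := (coord e₁ e₃ (c s)).re
    set b := (coord e₂ e₃ (c s)).re
    set a' := (coord e₁ e₃ (c t)).re
    set b' := (coord e₂ e₃ (c t)).re
    obtain ⟨x, y, hne, hr⟩ := hc.exists_combination hst (X := realVec e₁ e₂ e₃ a b)
      (Y := realVec e₁ e₂ e₃ a' b') (by rw [h.form_realVec, Complex.ofReal_re]; nlinarith)
      (by rw [h.form_realVec, Complex.ofReal_re]; nlinarith) es.symm et.symm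
      (by rw [h.form_realVec, Complex.ofReal_im]) r
    refine ⟨hc.1 r, ?_, ?_⟩
    · rw [← hr, coord_proj hne, form_add_right, form_add_right]
      simp only [form_smul_right, h.form_realVec₁, h.form_realVec₃]
      norm_cast
    · rw [← hr, coord_proj hne, form_add_right, form_add_right]
      simp only [form_smul_right, h.form_realVec₂, h.form_realVec₃]
      norm_cast

lemma continuousAt_coord (h : IsFrame e₁ e₂ e₃) (e : C2 × ℂ) {y : C2} (hy : ‖y‖ ≤ 1) :
    ContinuousAt (coord e e₃) y :=
  let ⟨_, hD, _⟩ := h.hasFDerivAt_coord e hy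
  hD.continuousAt

lemma continuousAt_proj {X : C2 × ℂ} (hX : X.2 ≠ 0) : ContinuousAt proj X :=
  (continuousAt_snd.inv₀ hX).smul continuousAt_fst

lemma proj_realVec_mem_closure (h : IsFrame e₁ e₂ e₃) {a b : ℝ} (hab : a ^ 2 + b ^ 2 = 1) :
    proj (realVec e₁ e₂ e₃ a b) ∈ closure (realPlane e₁ e₂ e₃) := by
  have hv : Continuous fun r : ℝ => realVec e₁ e₂ e₃ (r * a) (r * b) := by
    unfold realVec; fun_prop
  have h1 : realVec e₁ e₂ e₃ (1 * a) (1 * b) = realVec e₁ e₂ e₃ a b := by rw [one_mul, one_mul]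
  have hp : Filter.Tendsto proj (𝓝 (realVec e₁ e₂ e₃ (1 * a) (1 * b)))
      (𝓝 (proj (realVec e₁ e₂ e₃ a b))) := by
    rw [h1]; exact continuousAt_proj (h.realVec_snd_ne_zero hab.le)
  have ht := (hp.comp (hv.tendsto 1)).mono_left (nhdsWithin_le_nhds (s := Iio 1))
  refine mem_closure_of_tendsto ht ?_
  filter_upwards [Ioo_mem_nhdsLT (show (0 : ℝ) < 1 by norm_num)] with r hr
  have hlt : (r * a) ^ 2 + (r * b) ^ 2 < 1 := by
    have : (r * a) ^ 2 + (r * b) ^ 2 = r ^ 2 := by linear_combination r ^ 2 * hab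
    rw [this]; nlinarith [hr.1, hr.2]
  refine ⟨h.norm_proj_realVec_lt hlt, ?_, ?_⟩
  · rw [Function.comp, h.coord_realVec₁ hlt.le, Complex.ofReal_im]
  · rw [Function.comp, h.coord_realVec₂ hlt.le, Complex.ofReal_im]

/-- The boundary of the `ℝ`-plane of a frame is the `ℝ`-circle of the frame. -/
theorem closure_realPlane (h : IsFrame e₁ e₂ e₃) :
    closure (realPlane e₁ e₂ e₃) ∩ Metric.sphere 0 1 = realCircle e₁ e₂ e₃ := by
  ext y
  constructor
  · rintro ⟨hy, hy1⟩
    have hy1 : ‖y‖ = 1 := by simpa using hy1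
    obtain ⟨f, hf, hfy⟩ := mem_closure_iff_seq_limit.1 hy
    have hlim (e : C2 × ℂ) (he : ∀ z ∈ realPlane e₁ e₂ e₃, (coord e e₃ z).im = 0) :
        (coord e e₃ y).im = 0 := by
      have ht := (Complex.continuous_im.tendsto _).comp
        ((h.continuousAt_coord e hy1.le).tendsto.comp hfy)
      exact tendsto_nhds_unique ht (tendsto_const_nhds.congr fun n => (he _ (hf n)).symm)
    exact ⟨hy1, hlim e₁ fun z hz => hz.2.1, hlim e₂ fun z hz => hz.2.2⟩
  · rintro ⟨hy, h1, h2⟩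
    rw [h.eq_proj_realVec hy.le h1 h2]
    exact ⟨h.proj_realVec_mem_closure (h.coord_sq_eq_one hy h1 h2),
      by simpa using h.norm_proj_realVec_eq (h.coord_sq_eq_one hy h1 h2)⟩

theorem isRCircle (h : IsFrame e₁ e₂ e₃) {K : Set ExtHeis}
    (hK : toSphere '' K = realCircle e₁ e₂ e₃) : IsRCircle K :=
  ⟨_, h.isRPlane, by rw [hK, h.closure_realPlane]⟩

end IsFrame

/-! ### The mixed logarithmic derivative -/

/-- The mixed second derivative of the logarithm of `⟪x, y⟫ - 1` when `x` and `y` move with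
velocities `v` and `w`. -/
def mixed (x v y w : C2) : ℂ :=
  (⟪v, w⟫_ℂ * (⟪x, y⟫_ℂ - 1) - ⟪v, y⟫_ℂ * ⟪x, w⟫_ℂ) / (⟪x, y⟫_ℂ - 1) ^ 2

lemma mixed_smul_left (a : ℂ) (x v y w : C2) : mixed x (a • v) y w = conj a * mixed x v y w := by
  simp only [mixed, inner_smul_left]; ring

lemma mixed_smul_right (a : ℂ) (x v y w : C2) : mixed x v y (a • w) = a * mixed x v y w := by
  simp only [mixed, inner_smul_right]; ring

/-- The velocity of the point represented by `Z`, when `Z` moves with velocity `Z'`. -/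
def projDeriv (Z Z' : C2 × ℂ) : C2 := Z.2⁻¹ • (Z'.1 - Z'.2 • proj Z)

lemma hasDerivAt_proj {Z : ℝ → C2 × ℂ} {Z' : C2 × ℂ} {t : ℝ} (hZ : HasDerivAt Z Z' t)
    (h0 : (Z t).2 ≠ 0) : HasDerivAt (fun s => proj (Z s)) (projDeriv (Z t) Z') t := by
  have h1 : HasDerivAt (fun s => (Z s).1) Z'.1 t :=
    (hasFDerivAt_fst (𝕜 := ℝ) (p := Z t)).comp_hasDerivAt t hZ
  have h2 : HasDerivAt (fun s => (Z s).2) Z'.2 t :=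
    (hasFDerivAt_snd (𝕜 := ℝ) (p := Z t)).comp_hasDerivAt t hZ
  have h := (h2.inv h0).smul h1
  refine h.congr_deriv ?_
  simp only [projDeriv, proj, smul_sub, smul_smul, Pi.inv_apply]
  have : -Z'.2 / (Z t).2 ^ 2 = -((Z t).2⁻¹ * Z'.2 * (Z t).2⁻¹) := by field_simp
  rw [this, neg_smul, ← mul_assoc]
  abel

lemma prodMk_projDeriv {Z : C2 × ℂ} (h0 : Z.2 ≠ 0) (Z' : C2 × ℂ) :
    (projDeriv Z Z', (0 : ℂ)) = Z.2⁻¹ • Z' - (Z.2⁻¹ * Z'.2 * Z.2⁻¹) • Z := by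
  ext1
  · simp only [projDeriv, proj, smul_sub, smul_smul, Prod.fst_sub, Prod.smul_fst]
    rw [← mul_assoc]
  · simp only [Prod.snd_sub, Prod.smul_snd, smul_eq_mul]; field_simp; ring

/-- Passing to other lifts adds to the logarithm only terms depending on one of the two points, and
these disappear in the mixed derivative. So the value may be computed in any frame. -/
lemma mixed_proj {Z Z' W W' : C2 × ℂ} (hZ : Z.2 ≠ 0) (hW : W.2 ≠ 0) :
    mixed (proj Z) (projDeriv Z Z') (proj W) (projDeriv W W') =
      (form Z' W' * form Z W - form Z' W * form Z W') / form Z W ^ 2 := by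
  have e1 (v w : C2) : ⟪v, w⟫_ℂ = form (v, 0) (w, 0) := by simp [form]
  have e2 (v y : C2) : ⟪v, y⟫_ℂ = form (v, 0) (homog y) := by simp [form, homog]
  have e3 (x w : C2) : ⟪x, w⟫_ℂ = form (homog x) (w, 0) := by simp [form, homog]
  rw [mixed, ← form_homog, e1 (projDeriv Z Z'), e2 (projDeriv Z Z'), e3 _ (projDeriv W W'),
    prodMk_projDeriv hZ, prodMk_projDeriv hW, homog_proj hZ, homog_proj hW]
  simp only [form_sub_left, form_sub_right, form_smul_left, form_smul_right]
  by_cases h : form Z W = 0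
  · simp [h]
  have hZ' : conj Z.2 ≠ 0 := (map_ne_zero _).2 hZ
  simp only [map_mul, map_inv₀]
  field_simp
  ring

lemma inner_projDeriv {Z Z' : C2 × ℂ} (hZ : Z.2 ≠ 0) (h0 : form Z Z = 0) (h1 : form Z Z' = 0) :
    ⟪proj Z, projDeriv Z Z'⟫_ℂ = 0 := by
  have e3 (x w : C2) : ⟪x, w⟫_ℂ = form (homog x) (w, 0) := by simp [form, homog]
  rw [e3, prodMk_projDeriv hZ, homog_proj hZ]
  simp only [form_sub_right, form_smul_left, form_smul_right, h0, h1]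
  ring

lemma mem_contactPlane {x v : C2} : v ∈ contactPlane x ↔ ⟪x, v⟫_ℂ = 0 := by
  rw [contactPlane, Submodule.mem_orthogonal_singleton_iff_inner_right]

/-- On the real circle of a frame the mixed logarithmic derivative is real, and its sign is given
by the directions of rotation. -/
lemma IsFrame.mixed_eq {e₁ e₂ e₃ : C2 × ℂ} (h : IsFrame e₁ e₂ e₃) {a b c d κ τ : ℝ}
    (hab : a ^ 2 + b ^ 2 = 1) (hcd : c ^ 2 + d ^ 2 = 1) (hne : a * c + b * d ≠ 1) :
    mixed (proj (realVec e₁ e₂ e₃ a b))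
      (projDeriv (realVec e₁ e₂ e₃ a b) (((-(κ * b) : ℝ) : ℂ) • e₁ + ((κ * a : ℝ) : ℂ) • e₂))
      (proj (realVec e₁ e₂ e₃ c d))
      (projDeriv (realVec e₁ e₂ e₃ c d) (((-(τ * d) : ℝ) : ℂ) • e₁ + ((τ * c : ℝ) : ℂ) • e₂)) =
      ((κ * τ / (1 - (a * c + b * d)) : ℝ) : ℂ) := by
  rw [mixed_proj (h.realVec_snd_ne_zero hab.le) (h.realVec_snd_ne_zero hcd.le), h.form_realVec]
  have hform (p q p' q' : ℝ) : form ((p : ℂ) • e₁ + (q : ℂ) • e₂)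
      ((p' : ℂ) • e₁ + (q' : ℂ) • e₂) = ((p * p' + q * q' : ℝ) : ℂ) := by
    simp only [form_add_left, form_add_right, form_smul_left, form_smul_right, h.h11, h.h12,
      h.h21, h.h22, Complex.conj_ofReal]
    push_cast; ring
  have hform1 (p q p' q' : ℝ) : form ((p : ℂ) • e₁ + (q : ℂ) • e₂)
      (realVec e₁ e₂ e₃ p' q') = ((p * p' + q * q' : ℝ) : ℂ) := by
    simp only [realVec, form_add_left, form_add_right, form_smul_left, form_smul_right, h.h11,
      h.h12, h.h21, h.h22, h.h13, h.h23, Complex.conj_ofReal]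
    push_cast; ring
  have hform2 (p q p' q' : ℝ) : form (realVec e₁ e₂ e₃ p' q')
      ((p : ℂ) • e₁ + (q : ℂ) • e₂) = ((p * p' + q * q' : ℝ) : ℂ) := by
    rw [← form_conj, hform1, Complex.conj_ofReal]
  rw [hform, hform1, hform2]
  -- With `δ` the angle between `(a, b)` and `(c, d)`, the numerator is `κ τ (cos δ (cos δ - 1) +
  -- sin² δ) = κ τ (1 - cos δ)`.
  norm_cast
  have h1 : a * c + b * d - 1 ≠ 0 := sub_ne_zero.2 hne
  have h2 : 1 - (a * c + b * d) ≠ 0 := sub_ne_zero.2 (Ne.symm hne)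
  rw [div_eq_div_iff (pow_ne_zero 2 h1) h2]
  linear_combination (κ * τ * (1 - (a * c + b * d)) * (c ^ 2 + d ^ 2)) * hab +
    (κ * τ * (1 - (a * c + b * d))) * hcd

/-- A frame adapted to two null vectors and a unit vector orthogonal to them. -/
lemma isFrame_of_null {P Q E : C2 × ℂ} (hP : form P P = 0) (hQ : form Q Q = 0)
    (hPQ : form P Q = -1) (hE : form E E = 1) (hPE : form P E = 0) (hQE : form Q E = 0) :
    IsFrame E ((√2 : ℂ)⁻¹ • (P - Q)) ((√2 : ℂ)⁻¹ • (P + Q)) := by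
  have h2 : (√2 : ℂ) ^ 2 = 2 := by exact_mod_cast Real.sq_sqrt (show (0 : ℝ) ≤ 2 by norm_num)
  have h0 : (√2 : ℂ) ≠ 0 := by rintro h; rw [h] at h2; norm_num at h2
  have hQP : form Q P = -1 := by rw [← form_conj, hPQ]; simp
  have hEP : form E P = 0 := by rw [← form_conj, hPE, map_zero]
  have hEQ : form E Q = 0 := by rw [← form_conj, hQE, map_zero]
  constructor <;>
    simp only [form_add_left, form_add_right, form_sub_left, form_sub_right, form_smul_left,
      form_smul_right, hP, hQ, hPQ, hQP, hE, hEP, hEQ, map_inv₀, Complex.conj_ofReal] <;>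
    field_simp <;> (try rw [h2]) <;> norm_num

/-! ### `ℝ`-circles with a given tangent -/

/-- The standard parametrization of the `ℝ`-circle of a frame. -/
def circleParam (e₁ e₂ e₃ : C2 × ℂ) (φ : ℝ) : ExtHeis :=
  ofSphere (proj (realVec e₁ e₂ e₃ (Real.sin φ) (Real.cos φ)))

namespace IsFrame

variable {e₁ e₂ e₃ : C2 × ℂ}

lemma toSphere_circleParam (h : IsFrame e₁ e₂ e₃) (φ : ℝ) :
    toSphere (circleParam e₁ e₂ e₃ φ) = proj (realVec e₁ e₂ e₃ (Real.sin φ) (Real.cos φ)) :=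
  toSphere_ofSphere (h.norm_proj_realVec_eq (Real.sin_sq_add_cos_sq φ))

lemma hasDerivAt_realVec {a b : ℝ → ℝ} {a' b' t : ℝ} (ha : HasDerivAt a a' t)
    (hb : HasDerivAt b b' t) :
    HasDerivAt (fun s => realVec e₁ e₂ e₃ (a s) (b s)) ((a' : ℂ) • e₁ + (b' : ℂ) • e₂) t := by
  unfold realVec
  exact ((ha.ofReal_comp.smul_const e₁).add (hb.ofReal_comp.smul_const e₂)).add_const e₃

lemma velocity_circleParam (h : IsFrame e₁ e₂ e₃) (φ : ℝ) :
    velocity (circleParam e₁ e₂ e₃) φ =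
      projDeriv (realVec e₁ e₂ e₃ (Real.sin φ) (Real.cos φ))
        ((Real.cos φ : ℂ) • e₁ + ((-Real.sin φ : ℝ) : ℂ) • e₂) := by
  rw [velocity, funext h.toSphere_circleParam]
  exact (hasDerivAt_proj (hasDerivAt_realVec (Real.hasDerivAt_sin φ) (Real.hasDerivAt_cos φ))
    (h.realVec_snd_ne_zero (Real.sin_sq_add_cos_sq φ).le)).deriv

lemma isLegendrianParam_circleParam (h : IsFrame e₁ e₂ e₃) :
    IsLegendrianParam (circleParam e₁ e₂ e₃) where
  smooth := by
    rw [funext h.toSphere_circleParam]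
    have hZ : ContDiff ℝ ∞ fun φ => realVec e₁ e₂ e₃ (Real.sin φ) (Real.cos φ) := by
      unfold realVec
      have hs : ContDiff ℝ ∞ fun φ : ℝ => (Real.sin φ : ℂ) :=
        Complex.ofRealCLM.contDiff.comp Real.contDiff_sin
      have hc : ContDiff ℝ ∞ fun φ : ℝ => (Real.cos φ : ℂ) :=
        Complex.ofRealCLM.contDiff.comp Real.contDiff_cos
      exact ((hs.smul contDiff_const).add (hc.smul contDiff_const)).add contDiff_const
    unfold proj
    exact (hZ.snd.inv fun φ => h.realVec_snd_ne_zero (Real.sin_sq_add_cos_sq φ).le).smul hZ.fst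
  regular := fun φ h0 => by
    rw [h.velocity_circleParam] at h0
    have hZ := h.realVec_snd_ne_zero (Real.sin_sq_add_cos_sq φ).le
    set Z := realVec e₁ e₂ e₃ (Real.sin φ) (Real.cos φ) with hZd
    set Z' := (Real.cos φ : ℂ) • e₁ + ((-Real.sin φ : ℝ) : ℂ) • e₂ with hZ'
    have e := prodMk_projDeriv hZ Z'
    rw [h0] at e
    -- Zero velocity would make `Z'` a multiple of `Z`. Pairing with `e₃`, which sees `-1` in `Z`
    -- and nothing in `Z'`, shows that the multiple is zero, although `form Z' Z' = 1`.
    have e3 := congrArg (form e₃) e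
    rw [form_sub_right, form_smul_right, form_smul_right, hZd, h.form_realVec₃, ← hZd] at e3
    have h3 : form e₃ Z' = 0 := by
      rw [hZ', form_add_right, form_smul_right, form_smul_right, h.h31, h.h32]; ring
    have hz : form e₃ ((0 : C2), (0 : ℂ)) = 0 := by simp [form]
    rw [h3, hz] at e3
    have hk : Z.2⁻¹ * Z'.2 * Z.2⁻¹ = 0 := by linear_combination -e3
    rw [hk, zero_smul, sub_zero] at e
    have e1 := congrArg (form Z') e
    have hz' : form Z' ((0 : C2), (0 : ℂ)) = 0 := by simp [form]
    have hZZ : form Z' Z' = 1 := by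
      simp only [hZ', form_add_left, form_add_right, form_smul_left, form_smul_right, h.h11,
        h.h12, h.h21, h.h22, Complex.conj_ofReal]
      norm_cast
      nlinarith [Real.sin_sq_add_cos_sq φ]
    rw [hz', form_smul_right, hZZ, mul_one] at e1
    exact inv_ne_zero hZ e1.symm
  horizontal := fun φ => by
    rw [h.velocity_circleParam, h.toSphere_circleParam, mem_contactPlane]
    refine inner_projDeriv (h.realVec_snd_ne_zero (Real.sin_sq_add_cos_sq φ).le) ?_ ?_
    · rw [h.form_realVec]
      norm_cast
      linarith [Real.sin_sq_add_cos_sq φ]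
    · simp only [realVec, form_add_left, form_add_right, form_smul_left, form_smul_right, h.h11,
        h.h12, h.h21, h.h22, h.h31, h.h32, Complex.conj_ofReal]
      push_cast; ring
  closed_simple := by
    refine ⟨2 * Real.pi, by positivity, fun φ => by simp [circleParam], fun φ hφ ψ hψ heq => ?_⟩
    have e := congrArg toSphere heq
    rw [h.toSphere_circleParam, h.toSphere_circleParam] at e
    have e1 := congrArg (coord e₁ e₃) e
    have e2 := congrArg (coord e₂ e₃) e
    rw [h.coord_realVec₁ (Real.sin_sq_add_cos_sq φ).le,
      h.coord_realVec₁ (Real.sin_sq_add_cos_sq ψ).le] at e1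
    rw [h.coord_realVec₂ (Real.sin_sq_add_cos_sq φ).le,
      h.coord_realVec₂ (Real.sin_sq_add_cos_sq ψ).le] at e2
    have hang : (φ : Real.Angle) = ψ :=
      Real.Angle.cos_sin_inj (by exact_mod_cast e2) (by exact_mod_cast e1)
    rw [Real.Angle.angle_eq_iff_two_pi_dvd_sub] at hang
    obtain ⟨k, hk⟩ := hang
    have hpi := Real.pi_pos
    have hk1 : (-1 : ℝ) < k := by nlinarith [hφ.1, hψ.2]
    have hk2 : (k : ℝ) < 1 := by nlinarith [hφ.2, hψ.1]
    have : k = 0 := by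
      have h1 : -1 < k := by exact_mod_cast hk1
      have h2 : k < 1 := by exact_mod_cast hk2
      omega
    rw [this] at hk
    simp at hk
    linarith

lemma exists_sin_cos {a b : ℝ} (hab : a ^ 2 + b ^ 2 = 1) :
    ∃ φ, Real.sin φ = a ∧ Real.cos φ = b := by
  have hn : ‖(⟨b, a⟩ : ℂ)‖ = 1 := by
    rw [← sq_eq_sq₀ (norm_nonneg _) zero_le_one, Complex.sq_norm, Complex.normSq_apply]
    simp only
    nlinarith
  have h0 : (⟨b, a⟩ : ℂ) ≠ 0 := by rintro h; rw [h] at hn; simp at hn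
  refine ⟨Complex.arg ⟨b, a⟩, ?_, ?_⟩
  · rw [Complex.sin_arg, hn, div_one]
  · rw [Complex.cos_arg h0, hn, div_one]

lemma isRCircle_circleParam (h : IsFrame e₁ e₂ e₃) : IsRCircle (range (circleParam e₁ e₂ e₃)) := by
  refine h.isRCircle ?_
  ext y
  constructor
  · rintro ⟨_, ⟨φ, rfl⟩, rfl⟩
    have h1 := Real.sin_sq_add_cos_sq φ
    rw [h.toSphere_circleParam]
    refine ⟨h.norm_proj_realVec_eq h1, ?_, ?_⟩
    · rw [h.coord_realVec₁ h1.le, Complex.ofReal_im]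
    · rw [h.coord_realVec₂ h1.le, Complex.ofReal_im]
  · rintro ⟨hy, h1, h2⟩
    obtain ⟨φ, hs, hc⟩ := exists_sin_cos (h.coord_sq_eq_one hy h1 h2)
    refine ⟨_, ⟨φ, rfl⟩, ?_⟩
    rw [h.toSphere_circleParam, hs, hc, ← h.eq_proj_realVec hy.le h1 h2]

end IsFrame

/-- Through two distinct points of a Legendrian curve there is an `ℝ`-circle which is tangent to
the curve at the first one. -/
lemma IsLegendrianParam.exists_isTangentRCircle {γ : ℝ → ExtHeis} (hγ : IsLegendrianParam γ)
    {s : ℝ} {q : ExtHeis} (hq : γ s ≠ q) : ∃ α a b, IsTangentRCircle γ s q α a b := by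
  have hpq : toSphere (γ s) ≠ toSphere q := fun h => hq (toSphere_injective h)
  have hp1 := norm_toSphere (γ s)
  have hq1 := norm_toSphere q
  have hH := form_homog_ne hp1 hq1 hpq
  have hv0 := hγ.regular s
  have hv : ⟪toSphere (γ s), velocity γ s⟫_ℂ = 0 := mem_contactPlane.1 (hγ.horizontal s)
  set x := toSphere (γ s) with hx
  set y := toSphere q with hy
  set v := velocity γ s with hvd
  set k := form (homog x) (homog y) with hk
  set P : C2 × ℂ := homog x with hP
  set Q : C2 × ℂ := (-k⁻¹) • homog y with hQ
  set V : C2 × ℂ := (v, 0) with hV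
  have hPP : form P P = 0 := by rw [hP, form_homog_self, hp1]; simp
  have hQQ : form Q Q = 0 := by
    rw [hQ, form_smul_left, form_smul_right, form_homog_self, hq1]; simp
  have hPQ : form P Q = -1 := by
    rw [hQ, form_smul_right, ← hk, neg_mul, inv_mul_cancel₀ hH]
  have hQP : form Q P = -1 := by rw [← form_conj, hPQ]; simp
  have hPV : form P V = 0 := by
    rw [← hv]; simp [form, hP, hV, homog]
  have hVP : form V P = 0 := by rw [← form_conj, hPV, map_zero]
  have hn0 : 0 < ‖v‖ := norm_pos_iff.2 hv0
  have hn : (‖v‖ : ℂ) ≠ 0 := by exact_mod_cast hn0.ne'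
  have hVV : form V V = (‖v‖ : ℂ) ^ 2 := by rw [form_self]; simp [hV]
  -- `Q` is scaled so that `form P Q = -1`; the correction along `P` therefore makes `E₀` orthogonal
  -- to `Q`. It does not change the direction of motion of the represented point, since `P` is the
  -- lift of that point.
  set E₀ : C2 × ℂ := V + (form Q V) • P with hE₀
  set E : C2 × ℂ := (‖v‖ : ℂ)⁻¹ • E₀ with hE
  have hPE : form P E = 0 := by
    rw [hE, hE₀, form_smul_right, form_add_right, form_smul_right, hPV, hPP]; ring
  have hQE : form Q E = 0 := by
    rw [hE, hE₀, form_smul_right, form_add_right, form_smul_right, hQP]; ring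
  have hEE : form E E = 1 := by
    simp only [hE, hE₀, form_smul_left, form_smul_right, form_add_left, form_add_right, hVV, hVP,
      hPV, hPP, map_inv₀, Complex.conj_ofReal]
    field_simp
    ring
  have hF := isFrame_of_null hPP hQQ hPQ hEE hPE hQE
  have h22 : (√2 : ℂ) ^ 2 = 2 := by exact_mod_cast Real.sq_sqrt (show (0 : ℝ) ≤ 2 by norm_num)
  have h20 : (√2 : ℂ) ≠ 0 := by rintro h; rw [h] at h22; norm_num at h22
  set e₂ := (√2 : ℂ)⁻¹ • (P - Q) with he₂
  set e₃ := (√2 : ℂ)⁻¹ • (P + Q) with he₃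
  have hs2 : (√2 : ℂ)⁻¹ + (√2 : ℂ)⁻¹ = √2 := by field_simp; rw [h22]; norm_num
  have hs2' (X : C2 × ℂ) : (√2 : ℂ) • X = (√2 : ℂ)⁻¹ • X + (√2 : ℂ)⁻¹ • X := by
    rw [← add_smul, hs2]
  -- The standard parametrization starts at the point of `P` in the direction `E`, and reaches the
  -- point of `Q` at `π`.
  have hZ0 : realVec E e₂ e₃ (Real.sin 0) (Real.cos 0) = (√2 : ℂ) • P := by
    rw [realVec, he₂, he₃, hs2']; simp; module
  have hZpi : realVec E e₂ e₃ (Real.sin Real.pi) (Real.cos Real.pi) = (√2 : ℂ) • Q := by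
    rw [realVec, he₂, he₃, hs2']; simp; module
  refine ⟨circleParam E e₂ e₃, 0, Real.pi, hF.isLegendrianParam_circleParam,
    hF.isRCircle_circleParam, ?_, ?_, ?_⟩
  · apply toSphere_injective
    rw [hF.toSphere_circleParam, hZ0, proj_smul h20, hP, proj_homog]
  · refine ⟨(√2)⁻¹ * ‖v‖⁻¹, by positivity, ?_⟩
    rw [hF.velocity_circleParam, hZ0, projDeriv, proj_smul h20, hP, proj_homog, ← Complex.coe_smul]
    simp [hE, hE₀, hV, hP, homog, smul_smul, hvd]
  · apply toSphere_injective
    rw [hF.toSphere_circleParam, hZpi, proj_smul h20, hQ,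
      proj_smul (neg_ne_zero.2 (inv_ne_zero hH)), proj_homog]

/-! ### Curves with vanishing Cartan angular invariant -/

lemma im_div_eq_zero {z w : ℂ} (hz : z.im = 0) (hw : w.im = 0) : (z / w).im = 0 := by
  simp [Complex.div_im, hz, hw]

/-- A set of points of the sphere with vanishing Cartan angular invariant lies in an
`ℝ`-circle. -/
lemma exists_frame_of_cartan {T : Set C2} (hT : ∀ x ∈ T, ‖x‖ = 1)
    (hc : ∀ x ∈ T, ∀ y ∈ T, ∀ z ∈ T, (cartan x y z).im = 0) {x₀ x₁ x₂ : C2} (h₀ : x₀ ∈ T)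
    (h₁ : x₁ ∈ T) (h₂ : x₂ ∈ T) (h01 : x₀ ≠ x₁) (h02 : x₀ ≠ x₂) (h12 : x₁ ≠ x₂) :
    ∃ e₁ e₂ e₃, IsFrame e₁ e₂ e₃ ∧ T ⊆ realCircle e₁ e₂ e₃ := by
  set P : C2 × ℂ := homog x₀ with hP
  -- Lifts whose product with `P` is `-1`. Their mutual products are positive multiples of the
  -- Cartan triple product with `x₀`, hence real. At `x₀` itself `form P P = 0` and `l` degenerates
  -- to `0`.
  set l : C2 → C2 × ℂ := fun y => (-(form P (homog y))⁻¹) • homog y with hl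
  have hne {y : C2} (hy : y ∈ T) (h : x₀ ≠ y) : form P (homog y) ≠ 0 :=
    form_homog_ne (hT _ h₀) (hT _ hy) h
  have hPl {y : C2} (hy : y ∈ T) (h : x₀ ≠ y) : form P (l y) = -1 := by
    rw [hl, form_smul_right, neg_mul, inv_mul_cancel₀ (hne hy h)]
  have hll {y z : C2} (hy : y ∈ T) (hz : z ∈ T) (h : x₀ ≠ y) (h' : x₀ ≠ z) :
      (form (l y) (l z)).im = 0 := by
    have hy0 := hne hy h
    have hz0 := hne hz h'
    have hyc : conj (form P (homog y)) ≠ 0 := (map_ne_zero _).2 hy0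
    have hzc : conj (form P (homog z)) ≠ 0 := (map_ne_zero _).2 hz0
    have : form (l y) (l z) = cartan x₀ y z / ((Complex.normSq (form P (homog y)) *
        Complex.normSq (form P (homog z)) : ℝ) : ℂ) := by
      rw [cartan, ← hP, ← form_conj P (homog z)]
      simp only [hl, form_smul_left, form_smul_right, map_neg, map_inv₀]
      push_cast [← Complex.mul_conj]
      field_simp
    rw [this, Complex.div_ofReal_im, hc _ h₀ _ hy _ hz, zero_div]
  have hPP : form P P = 0 := by rw [hP, form_homog_self, hT _ h₀]; simp
  have hlself {y : C2} (hy : y ∈ T) : form (l y) (l y) = 0 := by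
    simp only [hl]
    rw [form_smul_left, form_smul_right, form_homog_self, hT _ hy]; simp
  have hPQ := hPl h₁ h01
  have hPR := hPl h₂ h02
  have hQQ := hlself h₁
  have hRR := hlself h₂
  have hQRim := hll h₁ h₂ h01 h02
  have hQR0 : form (l x₁) (l x₂) ≠ 0 := by
    simp only [hl]
    rw [form_smul_left, form_smul_right]
    exact mul_ne_zero ((map_ne_zero _).2 (neg_ne_zero.2 (inv_ne_zero (hne h₁ h01))))
      (mul_ne_zero (neg_ne_zero.2 (inv_ne_zero (hne h₂ h02)))
        (form_homog_ne (hT _ h₁) (hT _ h₂) h12))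
  obtain ⟨Q, hQ⟩ : ∃ Q, Q = l x₁ := ⟨_, rfl⟩
  obtain ⟨R, hR⟩ : ∃ R, R = l x₂ := ⟨_, rfl⟩
  rw [← hQ] at hPQ hQQ hQRim hQR0
  rw [← hR] at hPR hRR hQRim hQR0
  set r := (form Q R).re with hr
  have hQR : form Q R = (r : ℂ) := Complex.ext (by simp [hr]) (by simpa using hQRim)
  have hr0 : r ≠ 0 := by rintro h; rw [hQR, h] at hQR0; simp at hQR0
  have hQP : form Q P = -1 := by rw [← form_conj, hPQ]; simp
  have hRP : form R P = -1 := by rw [← form_conj, hPR]; simp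
  have hRQ : form R Q = (r : ℂ) := by rw [← form_conj, hQR, Complex.conj_ofReal]
  -- The component of `R` orthogonal to `P` and `Q`. Its square `-2 r` is positive because `E₀` is
  -- orthogonal to the negative vector `P + Q`.
  set E₀ : C2 × ℂ := R + (r : ℂ) • P - Q with hE₀
  have hPE₀ : form P E₀ = 0 := by
    rw [hE₀, form_sub_right, form_add_right, form_smul_right, hPR, hPP, hPQ]; ring
  have hQE₀ : form Q E₀ = 0 := by
    rw [hE₀, form_sub_right, form_add_right, form_smul_right, hQR, hQP, hQQ]; ring
  have hEE₀ : form E₀ E₀ = ((-2 * r : ℝ) : ℂ) := by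
    simp only [hE₀, form_sub_left, form_add_left, form_sub_right, form_add_right, form_smul_right,
      form_smul_left, hRR, hRP, hRQ, hPR, hPP, hPQ, hQR, hQP, hQQ, Complex.conj_ofReal]
    push_cast; ring
  have hE₀0 : E₀ ≠ 0 := by
    intro h
    rw [h] at hEE₀
    have : ((-2 * r : ℝ) : ℂ) = 0 := by rw [← hEE₀]; simp [form]
    have : -2 * r = 0 := by exact_mod_cast this
    exact hr0 (by linarith)
  have hpos : 0 < -2 * r := by
    have h := form_pos_of_orthogonal (P := P + Q) (U := E₀)
      (by
        simp only [form_add_left, form_add_right, hPP, hQQ, hPQ, hQP]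
        norm_num)
      (by rw [form_add_left, hPE₀, hQE₀, add_zero]) hE₀0
    rwa [hEE₀, Complex.ofReal_re] at h
  obtain ⟨n, hn0, hn2⟩ : ∃ n : ℝ, (n : ℂ) ≠ 0 ∧ (n : ℂ) ^ 2 = ((-2 * r : ℝ) : ℂ) :=
    ⟨√(-2 * r), Complex.ofReal_ne_zero.2 (Real.sqrt_pos.2 hpos).ne',
      by rw [← Complex.ofReal_pow, Real.sq_sqrt hpos.le]⟩
  have hF := isFrame_of_null (E := (n : ℂ)⁻¹ • E₀) hPP hQQ hPQ
    (by
      rw [form_smul_left, form_smul_right, hEE₀, map_inv₀, Complex.conj_ofReal, ← hn2]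
      field_simp)
    (by rw [form_smul_right, hPE₀, mul_zero]) (by rw [form_smul_right, hQE₀, mul_zero])
  refine ⟨_, _, _, hF, fun y hy => ?_⟩
  obtain ⟨Y, hY2, hYy, hPY, hQY, hRY⟩ : ∃ Y : C2 × ℂ, Y.2 ≠ 0 ∧ proj Y = y ∧
      (form P Y).im = 0 ∧ (form Q Y).im = 0 ∧ (form R Y).im = 0 := by
    -- At `x₀` the lift `P` is used, since `l x₀ = 0` represents no point.
    by_cases h : x₀ = y
    · refine ⟨P, by simp [hP, homog], by rw [hP, proj_homog, h], ?_, ?_, ?_⟩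
      · rw [hPP]; rfl
      · rw [hQP]; simp
      · rw [hRP]; simp
    · have h0 : -(form P (homog y))⁻¹ ≠ 0 := neg_ne_zero.2 (inv_ne_zero (hne hy h))
      refine ⟨l y, ?_, ?_, ?_, hQ ▸ hll h₁ hy h01 h, hR ▸ hll h₂ hy h02 h⟩
      · simpa [hl, homog] using hne hy h
      · rw [hl, proj_smul h0, proj_homog]
      · rw [hPl hy h]; simp
  have hinv (x : ℝ) (z : ℂ) (hz : z.im = 0) : (conj (x : ℂ)⁻¹ * z).im = 0 := by
    rw [map_inv₀, Complex.conj_ofReal, ← Complex.ofReal_inv, Complex.im_ofReal_mul, hz, mul_zero]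
  have hE₀Y : (form E₀ Y).im = 0 := by
    rw [hE₀, form_sub_left, form_add_left, form_smul_left, Complex.conj_ofReal]
    simp [hPY, hQY, hRY]
  refine ⟨hT y hy, ?_, ?_⟩
  · rw [← hYy, coord_proj hY2, Complex.neg_im, im_div_eq_zero, neg_zero]
    · rw [form_smul_left]; exact hinv _ _ hE₀Y
    · rw [form_smul_left]; exact hinv _ _ (by rw [form_add_left, Complex.add_im, hPY, hQY, add_zero])
  · rw [← hYy, coord_proj hY2, Complex.neg_im, im_div_eq_zero, neg_zero]
    · rw [form_smul_left]; exact hinv _ _ (by rw [form_sub_left, Complex.sub_im, hPY, hQY, sub_zero])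
    · rw [form_smul_left]; exact hinv _ _ (by rw [form_add_left, Complex.add_im, hPY, hQY, add_zero])

namespace IsLegendrianParam

variable {α : ℝ → ExtHeis}

lemma hasDerivAt (hα : IsLegendrianParam α) (t : ℝ) :
    HasDerivAt (fun s => toSphere (α s)) (velocity α t) t :=
  (hα.smooth.differentiable (by simp) t).hasDerivAt

lemma exists_frame (hα : IsLegendrianParam α)
    (hc : ∀ s t u, (cartan (toSphere (α s)) (toSphere (α t)) (toSphere (α u))).im = 0) :
    ∃ e₁ e₂ e₃, IsFrame e₁ e₂ e₃ ∧ ∀ t, toSphere (α t) ∈ realCircle e₁ e₂ e₃ := by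
  obtain ⟨L, hL, -, hinj⟩ := hα.closed_simple
  have hne {s t : ℝ} (hs : s ∈ Ico 0 L) (ht : t ∈ Ico 0 L) (hst : s ≠ t) :
      toSphere (α s) ≠ toSphere (α t) := fun h => hst (hinj hs ht (toSphere_injective h))
  have m0 : (0 : ℝ) ∈ Ico 0 L := ⟨le_rfl, hL⟩
  have m1 : L / 3 ∈ Ico 0 L := ⟨by positivity, by linarith⟩
  have m2 : L / 2 ∈ Ico 0 L := ⟨by positivity, by linarith⟩
  obtain ⟨e₁, e₂, e₃, hF, hsub⟩ := exists_frame_of_cartan (T := range fun t => toSphere (α t))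
    (by rintro _ ⟨t, rfl⟩; exact norm_toSphere _)
    (by rintro _ ⟨s, rfl⟩ _ ⟨t, rfl⟩ _ ⟨u, rfl⟩; exact hc s t u)
    (mem_range_self 0) (mem_range_self (L / 3)) (mem_range_self (L / 2))
    (hne m0 m1 (by linarith)) (hne m0 m2 (by linarith)) (hne m1 m2 (by linarith))
  exact ⟨e₁, e₂, e₃, hF, fun t => hsub (mem_range_self t)⟩

/-- In the affine coordinates of a frame, a Legendrian curve in the `ℝ`-circle of the frame rotates
on the unit circle with nonvanishing angular speed. -/
lemma exists_angular (hα : IsLegendrianParam α) {e₁ e₂ e₃ : C2 × ℂ} (h : IsFrame e₁ e₂ e₃)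
    (hreal : ∀ t, toSphere (α t) ∈ realCircle e₁ e₂ e₃) :
    ∃ a b κ : ℝ → ℝ, Continuous κ ∧ (∀ t, κ t ≠ 0) ∧
      (∀ t, HasDerivAt a (-(κ t * b t)) t) ∧ (∀ t, HasDerivAt b (κ t * a t) t) ∧
      (∀ t, a t ^ 2 + b t ^ 2 = 1) ∧
      (∀ t, toSphere (α t) = proj (realVec e₁ e₂ e₃ (a t) (b t))) ∧
      ∀ t, velocity α t = projDeriv (realVec e₁ e₂ e₃ (a t) (b t))
        (((-(κ t * b t) : ℝ) : ℂ) • e₁ + ((κ t * a t : ℝ) : ℂ) • e₂) := by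
  set a : ℝ → ℝ := fun t => (coord e₁ e₃ (toSphere (α t))).re with ha
  set b : ℝ → ℝ := fun t => (coord e₂ e₃ (toSphere (α t))).re with hb
  have hsm (e : C2 × ℂ) : ContDiff ℝ ∞ fun t => (coord e e₃ (toSphere (α t))).re := by
    have : ContDiff ℝ ∞ fun t => coord e e₃ (toSphere (α t)) := contDiff_iff_contDiffAt.2 fun t =>
      ContDiffAt.comp (g := coord e e₃) (f := fun t => toSphere (α t)) t
        (h.contDiffAt_coord e (norm_toSphere (α t)).le) hα.smooth.contDiffAt
    exact Complex.reCLM.contDiff.comp this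
  have hab (t : ℝ) : a t ^ 2 + b t ^ 2 = 1 :=
    h.coord_sq_eq_one (hreal t).1 (hreal t).2.1 (hreal t).2.2
  have hx (t : ℝ) : toSphere (α t) = proj (realVec e₁ e₂ e₃ (a t) (b t)) :=
    h.eq_proj_realVec (hreal t).1.le (hreal t).2.1 (hreal t).2.2
  have hda (t : ℝ) : HasDerivAt a (deriv a t) t :=
    ((hsm e₁).differentiable (by simp) t).hasDerivAt
  have hdb (t : ℝ) : HasDerivAt b (deriv b t) t :=
    ((hsm e₂).differentiable (by simp) t).hasDerivAt
  have horth (t : ℝ) : a t * deriv a t + b t * deriv b t = 0 := by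
    have h1 := ((hda t).pow 2).add ((hdb t).pow 2)
    have h2 : HasDerivAt (a ^ 2 + b ^ 2) 0 t := by
      rw [show a ^ 2 + b ^ 2 = fun _ => (1 : ℝ) from funext hab]
      exact hasDerivAt_const t 1
    have := h1.unique h2
    simp at this
    linarith
  set κ : ℝ → ℝ := fun t => a t * deriv b t - b t * deriv a t with hκ
  have ea (t : ℝ) : deriv a t = -(κ t * b t) := by
    simp only [hκ]
    linear_combination a t * horth t - deriv a t * hab t
  have eb (t : ℝ) : deriv b t = κ t * a t := by
    simp only [hκ]
    linear_combination b t * horth t - deriv b t * hab t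
  have hvel (t : ℝ) : velocity α t = projDeriv (realVec e₁ e₂ e₃ (a t) (b t))
        (((-(κ t * b t) : ℝ) : ℂ) • e₁ + ((κ t * a t : ℝ) : ℂ) • e₂) := by
    rw [velocity, funext hx, ← ea, ← eb]
    exact (hasDerivAt_proj (IsFrame.hasDerivAt_realVec (hda t) (hdb t))
      (h.realVec_snd_ne_zero (hab t).le)).deriv
  refine ⟨a, b, κ, ?_, fun t h0 => ?_, fun t => ea t ▸ hda t, fun t => eb t ▸ hdb t, hab, hx, hvel⟩
  · have := (hsm e₁).continuous_deriv (by simp)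
    have := (hsm e₂).continuous_deriv (by simp)
    have := (hsm e₁).continuous
    have := (hsm e₂).continuous
    fun_prop
  · apply hα.regular t
    rw [hvel, h0]
    simp [projDeriv]

/-- The mixed logarithmic derivative of a Legendrian curve with vanishing Cartan angular invariant
is positive. -/
lemma mixed_pos (hα : IsLegendrianParam α)
    (hc : ∀ s t u, (cartan (toSphere (α s)) (toSphere (α t)) (toSphere (α u))).im = 0)
    {s t : ℝ} (hst : α s ≠ α t) :
    ∃ ρ : ℝ, 0 < ρ ∧
      mixed (toSphere (α s)) (velocity α s) (toSphere (α t)) (velocity α t) = ρ := by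
  obtain ⟨e₁, e₂, e₃, h, hreal⟩ := hα.exists_frame hc
  obtain ⟨a, b, κ, hκc, hκ0, -, -, hab, hx, hv⟩ := hα.exists_angular h hreal
  have hle : a s * a t + b s * b t ≠ 1 := by
    intro h1
    have h2 : (a s - a t) ^ 2 + (b s - b t) ^ 2 = 0 := by nlinarith [hab s, hab t]
    have e1 : a s = a t := by nlinarith [sq_nonneg (a s - a t), sq_nonneg (b s - b t)]
    have e2 : b s = b t := by nlinarith [sq_nonneg (a s - a t), sq_nonneg (b s - b t)]
    exact hst (toSphere_injective (by rw [hx, hx, e1, e2]))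
  have hlt : a s * a t + b s * b t < 1 :=
    lt_of_le_of_ne (by nlinarith [hab s, hab t, sq_nonneg (a s - a t), sq_nonneg (b s - b t)]) hle
  -- The angular speed is continuous and has no zero, so it keeps one sign.
  have hκ : 0 < κ s * κ t := by
    by_contra hcon
    have hneg : κ s * κ t < 0 :=
      lt_of_le_of_ne (not_lt.1 hcon) (mul_ne_zero (hκ0 s) (hκ0 t))
    have hcont : Continuous fun u => κ s * κ u := by fun_prop
    obtain ⟨u, hu⟩ := mem_range_of_exists_le_of_exists_ge hcont ⟨t, hneg.le⟩
      ⟨s, mul_self_nonneg (κ s)⟩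
    exact mul_ne_zero (hκ0 s) (hκ0 u) hu
  refine ⟨κ s * κ t / (1 - (a s * a t + b s * b t)), div_pos hκ (by linarith), ?_⟩
  rw [hx s, hx t, hv s, hv t, h.mixed_eq (hab s) (hab t) hle]

/-- A Legendrian knot with vanishing Cartan angular invariant is an `ℝ`-circle. -/
lemma isRCircle_range (hα : IsLegendrianParam α)
    (hc : ∀ s t u, (cartan (toSphere (α s)) (toSphere (α t)) (toSphere (α u))).im = 0) :
    IsRCircle (range α) := by
  obtain ⟨e₁, e₂, e₃, h, hreal⟩ := hα.exists_frame hc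
  obtain ⟨a, b, κ, -, hκ0, hda, hdb, hab, hx, -⟩ := hα.exists_angular h hreal
  obtain ⟨L, hL, hper, -⟩ := hα.closed_simple
  refine h.isRCircle (Subset.antisymm ?_ ?_)
  · rintro _ ⟨_, ⟨t, rfl⟩, rfl⟩
    exact hreal t
  rintro y ⟨hy, h1, h2⟩
  by_contra hmiss
  have hcd := h.coord_sq_eq_one hy h1 h2
  have hyx := h.eq_proj_realVec hy.le h1 h2
  set c := (coord e₁ e₃ y).re
  set d := (coord e₂ e₃ y).re
  have hm (t : ℝ) : 1 - (c * a t + d * b t) ≠ 0 := by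
    intro h1
    have e1 : c = a t := by
      nlinarith [sq_nonneg (c - a t), sq_nonneg (d - b t), hab t]
    have e2 : d = b t := by
      nlinarith [sq_nonneg (c - a t), sq_nonneg (d - b t), hab t]
    exact hmiss ⟨α t, mem_range_self t, by rw [hx, hyx, e1, e2]⟩
  -- Stereographic projection from the missed point `(c, d)`: with `δ` the angle from that point,
  -- this is `sin δ / (1 - cos δ) = cot (δ/2)`. Its derivative never vanishes, while `σ` takes equal
  -- values at `0` and `L`, against Rolle's theorem.
  set σ : ℝ → ℝ := fun t => (c * b t - d * a t) / (1 - (c * a t + d * b t)) with hσ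
  have hσd (t : ℝ) : HasDerivAt σ (-κ t / (1 - (c * a t + d * b t))) t := by
    have hn := ((hdb t).const_mul c).sub ((hda t).const_mul d)
    have hmd := (((hda t).const_mul c).add ((hdb t).const_mul d)).const_sub 1
    refine (hn.div hmd (hm t)).congr_deriv ?_
    have := hm t
    simp only [Pi.add_apply, Pi.sub_apply]
    rw [div_eq_div_iff (pow_ne_zero 2 this) this]
    linear_combination (-(κ t) * (1 - (c * a t + d * b t)) * (a t ^ 2 + b t ^ 2)) * hcd -
      (κ t * (1 - (c * a t + d * b t))) * hab t
  have haL : a L = a 0 ∧ b L = b 0 := by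
    have e : toSphere (α L) = toSphere (α 0) := by
      rw [← hper 0, zero_add]
    rw [hx, hx] at e
    have e1 := congrArg (coord e₁ e₃) e
    have e2 := congrArg (coord e₂ e₃) e
    rw [h.coord_realVec₁ (hab _).le, h.coord_realVec₁ (hab _).le] at e1
    rw [h.coord_realVec₂ (hab _).le, h.coord_realVec₂ (hab _).le] at e2
    exact ⟨by exact_mod_cast e1, by exact_mod_cast e2⟩
  obtain ⟨t, -, ht⟩ := exists_hasDerivAt_eq_zero hL
    (fun t _ => (hσd t).continuousAt.continuousWithinAt) (by simp only [hσ, haL.1, haL.2])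
    (fun t _ => hσd t)
  exact div_ne_zero (neg_ne_zero.2 (hκ0 t)) (hm t) ht

end IsLegendrianParam

/-! ### From the mixed derivative to the Cartan angular invariant -/

lemma eq_of_hasDerivAt_zero {f : ℝ → ℝ} {a b x y : ℝ} (hf : ∀ t ∈ Ioo a b, HasDerivAt f 0 t)
    (hx : x ∈ Ioo a b) (hy : y ∈ Ioo a b) : f x = f y := by
  have := (convex_Ioo a b).norm_image_sub_le_of_norm_hasDerivWithin_le (C := 0)
    (fun t ht => (hf t ht).hasDerivWithinAt) (fun t _ => by simp) hx hy
  rw [zero_mul, norm_le_zero_iff, sub_eq_zero] at this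
  exact this.symm

/-- The second order Taylor expansion at a critical zero. -/
lemma tendsto_div_sq {f f' : ℝ → ℝ} {c u : ℝ} (hf : ∀ t, HasDerivAt f (f' t) t)
    (hf' : HasDerivAt f' c u) (h0 : f u = 0) (h0' : f' u = 0) :
    Filter.Tendsto (fun t => f t / (t - u) ^ 2) (𝓝[≠] u) (𝓝 (c / 2)) := by
  have hne : ∀ᶠ t in 𝓝[≠] u, t ≠ u := eventually_mem_nhdsWithin
  refine HasDerivAt.lhopital_zero_nhdsNE (f' := f') (g' := fun t => 2 * (t - u))
    (Filter.Eventually.of_forall hf) (Filter.Eventually.of_forall fun t => ?_) ?_ ?_ ?_ ?_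
  · refine (((hasDerivAt_id t).sub_const u).pow 2).congr_deriv ?_
    simp
  · filter_upwards [hne] with t ht
    exact mul_ne_zero two_ne_zero (sub_ne_zero.2 ht)
  · rw [← h0]
    exact (hf u).continuousAt.tendsto.mono_left nhdsWithin_le_nhds
  · have : Continuous fun t : ℝ => (t - u) ^ 2 := by fun_prop
    have h := this.tendsto u
    rw [sub_self, zero_pow two_ne_zero] at h
    exact h.mono_left nhdsWithin_le_nhds
  · have h := (hasDerivAt_iff_tendsto_slope.1 hf').div_const 2
    refine h.congr fun t => ?_
    rw [slope_def_field, h0', sub_zero, div_div, mul_comm]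

namespace IsLegendrianParam

variable {γ : ℝ → ExtHeis}

/-- The parametrization is injective on intervals shorter than its period. -/
lemma exists_period (hγ : IsLegendrianParam γ) : ∃ L, 0 < L ∧ Function.Periodic γ L ∧
    ∀ x y, γ x = γ y → |x - y| < L → x = y := by
  obtain ⟨L, hL, hper, hinj⟩ := hγ.closed_simple
  refine ⟨L, hL, hper, fun x y hxy hlt => ?_⟩
  obtain ⟨m, hm, -⟩ := existsUnique_zsmul_near_of_pos' hL x
  obtain ⟨n, hn, -⟩ := existsUnique_zsmul_near_of_pos' hL y
  have h := hinj hm hn (by rw [hper.sub_zsmul_eq, hper.sub_zsmul_eq, hxy])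
  simp only [zsmul_eq_mul] at h
  have e : x - y = ((m - n : ℤ) : ℝ) * L := by push_cast; linarith
  rw [e, abs_mul, abs_of_pos hL] at hlt
  have h1 : |((m - n : ℤ) : ℝ)| < 1 := by
    by_contra hcon
    push Not at hcon
    nlinarith
  have h2 : |m - n| < 1 := by exact_mod_cast h1
  rw [Int.abs_lt_one_iff.1 h2] at e
  simp at e
  linarith

lemma inner_velocity (hγ : IsLegendrianParam γ) (t : ℝ) :
    ⟪toSphere (γ t), velocity γ t⟫_ℂ = 0 := mem_contactPlane.1 (hγ.horizontal t)

lemma contDiff_velocity (hγ : IsLegendrianParam γ) : ContDiff ℝ ∞ (velocity γ) :=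
  (contDiff_infty_iff_deriv.1 hγ.smooth).2

/-- This is where the contact condition enters: differentiating `⟪x, x'⟫ = 0` gives `⟪x, x''⟫ =
-‖x'‖²`, so `1 - ⟪x(u), x(t)⟫` is `‖x'(u)‖² (t - u)² / 2` to leading order, a positive real number.
-/
lemma tendsto_arg (hγ : IsLegendrianParam γ) (u : ℝ) :
    Filter.Tendsto (fun t => (1 - ⟪toSphere (γ u), toSphere (γ t)⟫_ℂ).arg) (𝓝[≠] u) (𝓝 0) := by
  set x : ℝ → C2 := fun t => toSphere (γ t) with hx
  obtain ⟨w, hw⟩ : ∃ w, HasDerivAt (velocity γ) w u :=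
    ⟨_, (hγ.contDiff_velocity.differentiable (by simp) u).hasDerivAt⟩
  have hxw : ⟪x u, w⟫_ℂ = -((‖velocity γ u‖ ^ 2 : ℝ) : ℂ) := by
    have h1 := (hγ.hasDerivAt u).inner ℂ hw
    have h2 : HasDerivAt (fun t => ⟪toSphere (γ t), velocity γ t⟫_ℂ) 0 u := by
      rw [funext hγ.inner_velocity]; exact hasDerivAt_const u 0
    have h3 := h1.unique h2
    rw [inner_self_eq_norm_sq_to_K] at h3
    push_cast
    exact eq_neg_of_add_eq_zero_left h3
  set f : ℝ → ℂ := fun t => 1 - ⟪x u, x t⟫_ℂ with hf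
  have hfd (t : ℝ) : HasDerivAt f (-⟪x u, velocity γ t⟫_ℂ) t := by
    have h1 := ((hasDerivAt_const t (x u)).inner ℂ (hγ.hasDerivAt t)).const_sub 1
    refine h1.congr_deriv ?_
    simp
  have hfd' : HasDerivAt (fun t => -⟪x u, velocity γ t⟫_ℂ) (((‖velocity γ u‖ ^ 2 : ℝ) : ℂ)) u := by
    have h1 := ((hasDerivAt_const u (x u)).inner ℂ hw).neg
    refine h1.congr_deriv ?_
    rw [hxw]
    simp
  have hf0 : f u = 0 := by
    simp [hf, hx, inner_self_eq_norm_sq_to_K, norm_toSphere]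
  have hf0' : -⟪x u, velocity γ u⟫_ℂ = 0 := by rw [hx, hγ.inner_velocity, neg_zero]
  have hre := tendsto_div_sq (f := fun t => (f t).re)
    (fun t => (Complex.reCLM.hasFDerivAt.comp_hasDerivAt t (hfd t)))
    (Complex.reCLM.hasFDerivAt.comp_hasDerivAt u hfd') (by rw [hf0]; rfl)
    (by simp only [hf0', map_zero])
  have him := tendsto_div_sq (f := fun t => (f t).im)
    (fun t => (Complex.imCLM.hasFDerivAt.comp_hasDerivAt t (hfd t)))
    (Complex.imCLM.hasFDerivAt.comp_hasDerivAt u hfd') (by rw [hf0]; rfl)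
    (by simp only [hf0', map_zero])
  simp only [Complex.reCLM_apply, Complex.imCLM_apply, Complex.ofReal_re, Complex.ofReal_im,
    zero_div] at hre him
  have hv : 0 < ‖velocity γ u‖ := norm_pos_iff.2 (hγ.regular u)
  have hlim : Filter.Tendsto (fun t => (((t - u) ^ 2)⁻¹ : ℝ) * f t) (𝓝[≠] u)
      (𝓝 (((‖velocity γ u‖ ^ 2 / 2 : ℝ) : ℂ))) := by
    have h1 := ((Complex.continuous_ofReal.tendsto _).comp hre).add
      (((Complex.continuous_ofReal.tendsto _).comp him).mul_const Complex.I)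
    rw [Complex.ofReal_zero, zero_mul, add_zero] at h1
    refine h1.congr fun t => ?_
    simp only [Function.comp, div_eq_mul_inv]
    conv_rhs => rw [← Complex.re_add_im (f t)]
    push_cast; ring
  have hslit : (((‖velocity γ u‖ ^ 2 / 2 : ℝ) : ℂ)) ∈ Complex.slitPlane :=
    Complex.ofReal_mem_slitPlane.2 (by positivity)
  have harg := (Complex.continuousAt_arg hslit).tendsto.comp hlim
  rw [Complex.arg_ofReal_of_nonneg (by positivity)] at harg
  -- Division by the positive number `(t - u)²` does not affect the argument.
  refine harg.congr' ?_
  filter_upwards [(eventually_mem_nhdsWithin : ∀ᶠ t in 𝓝[≠] u, t ∈ ({u}ᶜ : Set ℝ))] with t ht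
  have : 0 < (t - u) ^ 2 := by
    have : t - u ≠ 0 := sub_ne_zero.2 ht
    positivity
  exact Complex.arg_real_mul _ (inv_pos.2 this)

lemma one_sub_inner_mem_slitPlane {p q : ExtHeis} (h : p ≠ q) :
    1 - ⟪toSphere p, toSphere q⟫_ℂ ∈ Complex.slitPlane := by
  have := form_homog_re_neg (norm_toSphere p) (norm_toSphere q)
    (fun e => h (toSphere_injective e))
  rw [form_homog, Complex.sub_re] at this
  refine Or.inl ?_
  rw [Complex.sub_re]; linarith

/-- The logarithmic derivative of `⟪x, y⟫ - 1` in the second point. -/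
lemma hasDerivAt_arg (hγ : IsLegendrianParam γ) {s t : ℝ} (h : γ s ≠ γ t) :
    HasDerivAt (fun r => (1 - ⟪toSphere (γ s), toSphere (γ r)⟫_ℂ).arg)
      (⟪toSphere (γ s), velocity γ t⟫_ℂ / (⟪toSphere (γ s), toSphere (γ t)⟫_ℂ - 1)).im t := by
  have h1 := ((hasDerivAt_const t (toSphere (γ s))).inner ℂ (hγ.hasDerivAt t)).const_sub 1
  have h2 := h1.clog_real (one_sub_inner_mem_slitPlane h)
  have h3 := Complex.imCLM.hasFDerivAt.comp_hasDerivAt t h2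
  refine (h3.congr_deriv ?_).congr_of_eventuallyEq (Filter.Eventually.of_forall fun r => ?_)
  · rw [Complex.imCLM_apply]
    congr 1
    rw [← neg_sub (1 : ℂ), div_neg]
    simp [neg_div]
  · simp [Complex.log_im]

/-- The derivative of this logarithmic derivative in the first point is `mixed`, whose imaginary
part is zero. Up to the period, the parameters of points other than `γ t` form the single interval
`(t - L, t)`, so one constant serves all of them. -/
lemma im_logDeriv_eq (hγ : IsLegendrianParam γ)
    (hm : ∀ s t, γ s ≠ γ t →
      (mixed (toSphere (γ s)) (velocity γ s) (toSphere (γ t)) (velocity γ t)).im = 0)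
    {s u t : ℝ} (hs : γ s ≠ γ t) (hu : γ u ≠ γ t) :
    (⟪toSphere (γ s), velocity γ t⟫_ℂ / (⟪toSphere (γ s), toSphere (γ t)⟫_ℂ - 1)).im =
      (⟪toSphere (γ u), velocity γ t⟫_ℂ / (⟪toSphere (γ u), toSphere (γ t)⟫_ℂ - 1)).im := by
  obtain ⟨L, hL, hper, hinj⟩ := hγ.exists_period
  have hne {r : ℝ} (hr : r ∈ Ioo (t - L) t) : γ r ≠ γ t := fun h =>
    hr.2.ne (hinj r t h (abs_lt.2 ⟨by linarith [hr.1], by linarith [hr.2]⟩))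
  have hshift {r : ℝ} (hr : γ r ≠ γ t) : ∃ r' ∈ Ioo (t - L) t, γ r = γ r' := by
    obtain ⟨r', hr', er⟩ := hper.exists_mem_Ico hL r (t - L)
    refine ⟨r', ⟨lt_of_le_of_ne hr'.1 ?_, by linarith [hr'.2]⟩, er⟩
    rintro rfl
    exact hr (er.trans (hper.sub_eq t))
  obtain ⟨s', hs', es⟩ := hshift hs
  obtain ⟨u', hu', eu⟩ := hshift hu
  rw [es, eu]
  refine eq_of_hasDerivAt_zero (f := fun r => (⟪toSphere (γ r), velocity γ t⟫_ℂ /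
    (⟪toSphere (γ r), toSphere (γ t)⟫_ℂ - 1)).im) (fun r hr => ?_) hs' hu'
  have h0 : ⟪toSphere (γ r), toSphere (γ t)⟫_ℂ - 1 ≠ 0 := by
    rw [← form_homog]
    exact form_homog_ne (norm_toSphere _) (norm_toSphere _)
      fun e => hne hr (toSphere_injective e)
  have h1 := (hγ.hasDerivAt r).inner ℂ (hasDerivAt_const r (velocity γ t))
  have h2 := ((hγ.hasDerivAt r).inner ℂ (hasDerivAt_const r (toSphere (γ t)))).sub_const 1
  have h3 := Complex.imCLM.hasFDerivAt.comp_hasDerivAt r (h1.div h2 h0)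
  refine h3.congr_deriv ?_
  rw [Complex.imCLM_apply, ← hm r t (hne hr)]
  congr 1
  simp only [mixed, inner_zero_right, zero_add]
  ring

/-- The argument of `1 - ⟪x, y⟫` is additive along the curve if the mixed derivative is real. -/
lemma arg_add (hγ : IsLegendrianParam γ)
    (hm : ∀ s t, γ s ≠ γ t →
      (mixed (toSphere (γ s)) (velocity γ s) (toSphere (γ t)) (velocity γ t)).im = 0)
    {s u t : ℝ} (hsu : γ s ≠ γ u) (hst : γ s ≠ γ t) (hut : γ u ≠ γ t) :
    (1 - ⟪toSphere (γ s), toSphere (γ t)⟫_ℂ).arg =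
      (1 - ⟪toSphere (γ s), toSphere (γ u)⟫_ℂ).arg +
        (1 - ⟪toSphere (γ u), toSphere (γ t)⟫_ℂ).arg := by
  obtain ⟨L, hL, hper, hinj⟩ := hγ.exists_period
  have hshift {r : ℝ} (hr : γ s ≠ γ r) : ∃ r' ∈ Ioo s (s + L), γ r = γ r' := by
    obtain ⟨r', hr', er⟩ := hper.exists_mem_Ico hL r s
    refine ⟨r', ⟨lt_of_le_of_ne hr'.1 ?_, hr'.2⟩, er⟩
    rintro rfl
    exact hr er.symm
  obtain ⟨u', hu', eu⟩ := hshift hsu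
  obtain ⟨t', ht', et⟩ := hshift hst
  rw [eu] at hsu hut ⊢
  rw [et] at hst hut ⊢
  -- `D` has zero derivative on `(s, s + L)` away from `u'`, and its limit at `u'` from both sides
  -- is the argument for `(s, u')` by `tendsto_arg`. So it has this value on either side of `u'`.
  set D : ℝ → ℝ := fun r => (1 - ⟪toSphere (γ s), toSphere (γ r)⟫_ℂ).arg -
    (1 - ⟪toSphere (γ u'), toSphere (γ r)⟫_ℂ).arg with hD
  have hDlim : Filter.Tendsto D (𝓝[≠] u') (𝓝 (1 - ⟪toSphere (γ s), toSphere (γ u')⟫_ℂ).arg) := by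
    have h1 := (hγ.hasDerivAt_arg hsu).continuousAt.tendsto.mono_left
      (nhdsWithin_le_nhds (s := {u'}ᶜ))
    have := h1.sub (hγ.tendsto_arg u')
    rwa [sub_zero] at this
  have hDd {r : ℝ} (hr : r ∈ Ioo s (s + L)) (hru : r ≠ u') : HasDerivAt D 0 r := by
    have hsr : γ s ≠ γ r := fun h =>
      hr.1.ne (hinj s r h (abs_lt.2 ⟨by linarith [hr.2], by linarith [hr.1]⟩))
    have hur : γ u' ≠ γ r := fun h => hru (hinj u' r h
      (abs_lt.2 ⟨by linarith [hr.2, hu'.1], by linarith [hr.1, hu'.2]⟩)).symm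
    refine ((hγ.hasDerivAt_arg hsr).sub (hγ.hasDerivAt_arg hur)).congr_deriv ?_
    rw [hγ.im_logDeriv_eq hm hsr hur, sub_self]
  have htu : t' ≠ u' := by rintro rfl; exact hut rfl
  have key : D t' = (1 - ⟪toSphere (γ s), toSphere (γ u')⟫_ℂ).arg := by
    rcases lt_or_gt_of_ne htu with h | h
    · have hlim := hDlim.mono_left (nhdsWithin_mono u' (fun r hr => (ne_of_lt hr : r ≠ u')) :
        𝓝[<] u' ≤ 𝓝[≠] u')
      refine tendsto_nhds_unique (tendsto_const_nhds.congr' ?_) hlim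
      filter_upwards [Ioo_mem_nhdsLT hu'.1] with r hr
      exact eq_of_hasDerivAt_zero (fun z hz => hDd ⟨hz.1, hz.2.trans hu'.2⟩ hz.2.ne)
        ⟨ht'.1, h⟩ hr
    · have hlim := hDlim.mono_left (nhdsWithin_mono u' (fun r hr => (ne_of_gt hr : r ≠ u')) :
        𝓝[>] u' ≤ 𝓝[≠] u')
      refine tendsto_nhds_unique (tendsto_const_nhds.congr' ?_) hlim
      filter_upwards [Ioo_mem_nhdsGT hu'.2] with r hr
      exact eq_of_hasDerivAt_zero (fun z hz => hDd ⟨hu'.1.trans hz.1, hz.2⟩ hz.1.ne')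
        ⟨h, ht'.2⟩ hr
  simp only [hD] at key
  linarith

/-- If the mixed logarithmic derivative is real, then the Cartan angular invariant vanishes. -/
lemma cartan_im_eq_zero (hγ : IsLegendrianParam γ)
    (hm : ∀ s t, γ s ≠ γ t →
      (mixed (toSphere (γ s)) (velocity γ s) (toSphere (γ t)) (velocity γ t)).im = 0) (s u t : ℝ) :
    (cartan (toSphere (γ s)) (toSphere (γ u)) (toSphere (γ t))).im = 0 := by
  have hself (p : ExtHeis) : form (homog (toSphere p)) (homog (toSphere p)) = 0 := by
    rw [form_homog_self, norm_toSphere]; simp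
  by_cases hsu : γ s = γ u
  · rw [cartan, hsu, hself]; simp
  by_cases hst : γ s = γ t
  · rw [cartan, hst, hself]; simp
  by_cases hut : γ u = γ t
  · rw [cartan, hut, hself]; simp
  have hadd := hγ.arg_add hm hsu hst hut
  set a := 1 - ⟪toSphere (γ s), toSphere (γ u)⟫_ℂ with ha
  set b := 1 - ⟪toSphere (γ u), toSphere (γ t)⟫_ℂ with hb
  set c := 1 - ⟪toSphere (γ s), toSphere (γ t)⟫_ℂ with hc
  have hc' : form (homog (toSphere (γ t))) (homog (toSphere (γ s))) = -conj c := by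
    rw [form_homog, hc, map_sub, inner_conj_symm, map_one]; ring
  have hprod : cartan (toSphere (γ s)) (toSphere (γ u)) (toSphere (γ t)) = -(a * b * conj c) := by
    rw [cartan, hc', form_homog, form_homog, ha, hb]; ring
  -- By additivity the arguments of `a`, `b` and `conj c` cancel.
  have hexp : a * b * conj c = ((‖a‖ * ‖b‖ * ‖c‖ : ℝ) : ℂ) := by
    have e : a * b * conj c = (‖a‖ * Complex.exp (a.arg * Complex.I)) *
        (‖b‖ * Complex.exp (b.arg * Complex.I)) *
        conj (‖c‖ * Complex.exp (c.arg * Complex.I)) := by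
      rw [Complex.norm_mul_exp_arg_mul_I, Complex.norm_mul_exp_arg_mul_I,
        Complex.norm_mul_exp_arg_mul_I]
    rw [e, map_mul, Complex.conj_ofReal, ← Complex.exp_conj, map_mul, Complex.conj_ofReal,
      Complex.conj_I, hadd]
    have h1 : Complex.exp (a.arg * Complex.I) * Complex.exp (b.arg * Complex.I) *
        Complex.exp (((a.arg + b.arg : ℝ) : ℂ) * -Complex.I) = 1 := by
      rw [← Complex.exp_add, ← Complex.exp_add]
      push_cast
      ring_nf
      simp
    push_cast at h1 ⊢
    linear_combination (‖a‖ * ‖b‖ * ‖c‖ : ℂ) * h1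
  rw [hprod, hexp, Complex.neg_im, Complex.ofReal_im, neg_zero]

/-- Two parametrizations of the same Legendrian knot have proportional velocities. -/
lemma exists_velocity_eq_smul {δ : ℝ → ExtHeis} (hγ : IsLegendrianParam γ)
    (hδ : IsLegendrianParam δ) (hr : range δ ⊆ range γ) {s t : ℝ} (hst : γ s = δ t) :
    ∃ c : ℝ, velocity δ t = c • velocity γ s := by
  obtain ⟨L, hL, hper, hinj⟩ := hγ.exists_period
  have hex (r : ℝ) : ∃ r' ∈ Ico (s - L / 2) (s - L / 2 + L), δ r = γ r' := by
    obtain ⟨w, hw⟩ := hr (mem_range_self r)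
    obtain ⟨r', hr', er⟩ := hper.exists_mem_Ico hL w (s - L / 2)
    exact ⟨r', hr', hw ▸ er⟩
  -- The change of parameter, with values in a window of one period centred at `s`. No regularity of
  -- `τ` is known yet.
  choose τ hτ hδτ using hex
  have hcγ : Continuous fun r => toSphere (γ r) := hγ.smooth.continuous
  have hcδ : Continuous fun r => toSphere (δ r) := hδ.smooth.continuous
  have hlim : Filter.Tendsto τ (𝓝 t) (𝓝 s) := by
    -- Continuity at `t` by compactness: a cluster point `x` of `τ` satisfies `γ x = γ s` and `|x -
    -- s| ≤ L / 2 < L`, so it is `s`.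
    refine (isCompact_Icc (a := s - L / 2) (b := s - L / 2 + L)).tendsto_nhds_of_unique_mapClusterPt
      (Filter.Eventually.of_forall fun r => Ico_subset_Icc_self (hτ r)) fun x hx hcl => ?_
    have h1 := hcl.continuousAt_comp hcγ.continuousAt
    have h2 : Filter.Tendsto ((fun r => toSphere (γ r)) ∘ τ) (𝓝 t) (𝓝 (toSphere (δ t))) := by
      refine (hcδ.tendsto t).congr fun r => ?_
      rw [Function.comp, ← hδτ]
    have h3 : toSphere (γ x) = toSphere (δ t) := by
      by_contra hne
      have := h1.clusterPt.mono h2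
      exact hne (eq_of_nhds_neBot this)
    have h4 : γ x = γ s := (toSphere_injective h3).trans hst.symm
    refine hinj x s h4 (abs_lt.2 ⟨?_, ?_⟩) <;> linarith [hx.1, hx.2]
  set v := velocity γ s with hv
  set w := velocity δ t with hw
  set A : ℝ → C2 := fun r => dslope (fun r => toSphere (γ r)) s (τ r) with hA
  set B : ℝ → C2 := fun r => dslope (fun r => toSphere (δ r)) t r with hB
  have hAlim : Filter.Tendsto A (𝓝[≠] t) (𝓝 v) := by
    have h1 : ContinuousAt (dslope (fun r => toSphere (γ r)) s) s :=
      continuousAt_dslope_same.2 (hγ.hasDerivAt s).differentiableAt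
    have h2 := h1.tendsto
    rw [dslope_same] at h2
    exact (h2.comp hlim).mono_left nhdsWithin_le_nhds
  have hBlim : Filter.Tendsto B (𝓝[≠] t) (𝓝 w) := by
    have h1 : ContinuousAt (dslope (fun r => toSphere (δ r)) t) t :=
      continuousAt_dslope_same.2 (hδ.hasDerivAt t).differentiableAt
    have h2 := h1.tendsto
    rw [dslope_same] at h2
    exact h2.mono_left nhdsWithin_le_nhds
  -- The difference quotient of `τ`. Since `q • A = B` with `A → v ≠ 0` and `B → w`, pairing with
  -- `v` shows that `q` converges, and its limit is the factor sought.
  set q : ℝ → ℝ := fun r => (τ r - s) / (r - t) with hq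
  have hqA : ∀ᶠ r in 𝓝[≠] t, q r • A r = B r := by
    filter_upwards [(eventually_mem_nhdsWithin : ∀ᶠ r in 𝓝[≠] t, r ∈ ({t}ᶜ : Set ℝ))] with r hr
    have hrt : r - t ≠ 0 := sub_ne_zero.2 hr
    have e1 : (τ r - s) • A r = toSphere (γ (τ r)) - toSphere (γ s) := sub_smul_dslope _ _ _
    have e2 : (r - t) • B r = toSphere (δ r) - toSphere (δ t) := sub_smul_dslope _ _ _
    rw [← hδτ, hst, ← e2] at e1
    simp only [hq]
    rw [div_eq_inv_mul, mul_smul, e1, smul_smul, inv_mul_cancel₀ hrt, one_smul]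
  have hip : Continuous fun z : C2 => (⟪v, z⟫_ℂ).re := by fun_prop
  have hvv : 0 < (⟪v, v⟫_ℂ).re := by
    have h : (⟪v, v⟫_ℂ).re = ‖v‖ ^ 2 := inner_self_eq_norm_sq (𝕜 := ℂ) v
    have : 0 < ‖v‖ := norm_pos_iff.2 (hγ.regular s)
    rw [h]
    positivity
  have hA2 := (hip.tendsto v).comp hAlim
  have hB2 := (hip.tendsto w).comp hBlim
  have hqlim : Filter.Tendsto q (𝓝[≠] t) (𝓝 ((⟪v, w⟫_ℂ).re / (⟪v, v⟫_ℂ).re)) := by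
    refine (hB2.div hA2 hvv.ne').congr' ?_
    filter_upwards [hqA, hA2.eventually_ne hvv.ne'] with r hr hne
    simp only [Pi.div_apply, Function.comp] at hne ⊢
    rw [← hr, ← Complex.coe_smul, inner_smul_right, Complex.re_ofReal_mul]
    field_simp
  refine ⟨(⟪v, w⟫_ℂ).re / (⟪v, v⟫_ℂ).re, ?_⟩
  exact tendsto_nhds_unique hBlim ((hqlim.smul hAlim).congr' hqA)

end IsLegendrianParam

/-! ### The angle -/

/-- In `ℂ²` the contact plane is a complex line; this is why a single complex number records the
angle between two horizontal directions. -/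
lemma exists_eq_smul_of_mem_contactPlane {x v w : C2} (hx : x ≠ 0) (hv : v ∈ contactPlane x)
    (hw : w ∈ contactPlane x) (hw0 : w ≠ 0) : ∃ z : ℂ, v = z • w := by
  have : Fact (Module.finrank ℂ C2 = 2) := ⟨by simp⟩
  have h := Submodule.mem_span_singleton_of_inner_eq_zero_of_inner_eq_zero hx hw0
    (mem_contactPlane.1 hv) (mem_contactPlane.1 hw)
  obtain ⟨z, hz⟩ := Submodule.mem_span_singleton.1 h
  exact ⟨z, hz.symm⟩

lemma vectorAngle_smul_left {z : ℂ} {w : C2} (hw : w ≠ 0) :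
    vectorAngle (z • w) w = Real.arccos (z.re / ‖z‖) := by
  have h : (⟪z • w, w⟫_ℂ).re = z.re * ‖w‖ ^ 2 := by
    have hww : (⟪w, w⟫_ℂ) = ((‖w‖ ^ 2 : ℝ) : ℂ) := by
      rw [inner_self_eq_norm_sq_to_K]; push_cast; rfl
    rw [inner_smul_left, hww, mul_comm, Complex.re_ofReal_mul, Complex.conj_re, mul_comm]
  have hn : ‖w‖ ≠ 0 := norm_ne_zero_iff.2 hw
  rw [vectorAngle, h, norm_smul]
  congr 1
  by_cases hz : ‖z‖ = 0
  · simp [hz]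
  · field_simp

lemma im_eq_zero_of_arccos {z : ℂ} (hz : z ≠ 0)
    (h : Real.arccos (z.re / ‖z‖) = 0 ∨ Real.arccos (z.re / ‖z‖) = Real.pi) : z.im = 0 := by
  have hn : 0 < ‖z‖ := norm_pos_iff.2 hz
  rw [Real.arccos_eq_zero, Real.arccos_eq_pi, le_div_iff₀ hn, div_le_iff₀ hn] at h
  have hsq : ‖z‖ ^ 2 = z.re ^ 2 + z.im ^ 2 := by
    rw [Complex.sq_norm, Complex.normSq_apply]; ring
  rcases h with h | h <;> nlinarith [sq_nonneg z.im]

/-- The mixed logarithmic derivative determines the angle between the tangent `ℝ`-circles. -/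
lemma exists_angle_eq {γ α β : ℝ → ExtHeis} {s t a a' b b' : ℝ}
    (hst : γ s ≠ γ t) (hα : IsTangentRCircle γ s (γ t) α a a')
    (hβ : IsTangentRCircle γ t (γ s) β b b') :
    ∃ (z : ℂ) (c : ℝ), z ≠ 0 ∧ 0 < c ∧
      vectorAngle (velocity α a) (velocity β b') = Real.arccos (z.re / ‖z‖) ∧
      mixed (toSphere (γ s)) (velocity γ s) (toSphere (γ t)) (velocity γ t) =
        (c : ℂ) * conj z := by
  obtain ⟨c₁, hc₁, hv₁⟩ := hα.tangent
  obtain ⟨c₂, hc₂, hv₂⟩ := hβ.tangent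
  have hx0 : toSphere (γ s) ≠ 0 := by
    intro h
    have := norm_toSphere (γ s)
    rw [h] at this; simp at this
  have hcα : velocity α a ∈ contactPlane (toSphere (γ s)) := hα.base ▸ hα.param.horizontal a
  have hcβ : velocity β b' ∈ contactPlane (toSphere (γ s)) := hβ.target ▸ hβ.param.horizontal b'
  have hβ0 := hβ.param.regular b'
  obtain ⟨z, hz⟩ := exists_eq_smul_of_mem_contactPlane hx0 hcα hcβ hβ0
  -- The ℝ-circle `β` passes through both points, so its own mixed derivative is a positive `ρ`. At
  -- `γ t` the curve has the direction of `β`, at `γ s` that of `z` times `β`; conjugate-linearity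
  -- in the first velocity produces `conj z`.
  obtain ⟨ρ, hρ, hm⟩ := hβ.param.mixed_pos (s := b') (t := b)
    (fun r s t => hβ.rCircle.cartan_im (mem_range_self r) (mem_range_self s) (mem_range_self t))
    (by rw [hβ.base, hβ.target]; exact hst)
  have hz0 : z ≠ 0 := by
    rintro rfl
    rw [zero_smul] at hz
    exact hα.param.regular a hz
  have hγs : velocity γ s = ((c₁⁻¹ : ℝ) : ℂ) • z • velocity β b' := by
    rw [← hz, hv₁, Complex.coe_smul, smul_smul, inv_mul_cancel₀ hc₁.ne', one_smul]
  have hγt : velocity γ t = ((c₂⁻¹ : ℝ) : ℂ) • velocity β b := by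
    rw [hv₂, Complex.coe_smul, smul_smul, inv_mul_cancel₀ hc₂.ne', one_smul]
  refine ⟨z, c₁⁻¹ * c₂⁻¹ * ρ, hz0, by positivity, ?_, ?_⟩
  · rw [hz, vectorAngle_smul_left hβ0]
  · rw [hγs, hγt, mixed_smul_left, mixed_smul_left, mixed_smul_right, ← hβ.base, ← hβ.target, hm,
      Complex.conj_ofReal]
    push_cast; ring

/-- The angle of a Legendrian knot is realized by some choice of tangent `ℝ`-circles. -/
lemma isKnotAngle_knotAngle {γ : ℝ → ExtHeis} (hγ : IsLegendrianParam γ) {s t : ℝ}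
    (hst : γ s ≠ γ t) :
    IsKnotAngle (range γ) (γ s) (γ t) (knotAngle (range γ) (γ s) (γ t)) := by
  obtain ⟨α, a, a', hα⟩ := hγ.exists_isTangentRCircle hst
  obtain ⟨β, b, b', hβ⟩ := hγ.exists_isTangentRCircle (Ne.symm hst)
  -- Existence of tangent ℝ-circles makes the chosen value a genuine angle. Uniqueness is not
  -- needed, because `exists_angle_eq` applies to every realization.
  exact Classical.epsilon_spec (p := IsKnotAngle (range γ) (γ s) (γ t))
    ⟨_, γ, s, t, α, β, a, a', b, b', hγ, rfl, rfl, rfl, hα, hβ, rfl⟩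

/-- If the angle is `0` or `π`, then the mixed logarithmic derivative is real. -/
lemma mixed_im_eq_zero {γ : ℝ → ExtHeis} (hγ : IsLegendrianParam γ) {s t : ℝ} (hst : γ s ≠ γ t)
    (h : knotAngle (range γ) (γ s) (γ t) = 0 ∨ knotAngle (range γ) (γ s) (γ t) = Real.pi) :
    (mixed (toSphere (γ s)) (velocity γ s) (toSphere (γ t)) (velocity γ t)).im = 0 := by
  obtain ⟨δ, s', t', α, β, a, a', b, b', hδ, hr, hs, ht, hα, hβ, hθ⟩ := isKnotAngle_knotAngle hγ hst
  rw [← ht] at hα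
  rw [← hs] at hβ
  obtain ⟨z, c, hz, -, hang, hm⟩ := exists_angle_eq (by rw [hs, ht]; exact hst) hα hβ
  have hzim : z.im = 0 := im_eq_zero_of_arccos hz (by rwa [← hang, ← hθ])
  -- The angle may be realized through another parametrization `δ`; the velocities then differ by
  -- real factors, which keep `mixed` real.
  obtain ⟨k, hk⟩ := hδ.exists_velocity_eq_smul hγ hr.ge hs
  obtain ⟨l, hl⟩ := hδ.exists_velocity_eq_smul hγ hr.ge ht
  rw [hk, hl, ← Complex.coe_smul, ← Complex.coe_smul, mixed_smul_left, mixed_smul_right,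
    ← hs, ← ht, hm, Complex.conj_ofReal]
  simp [hzim]

end HeisKnot

end

/-! ### Proof of the proposition -/

theorem mainTheorem9 (K : Set HeisKnot.ExtHeis) (hK : HeisKnot.IsLegendrianKnot K)
    (hangle : ∀ p ∈ K, ∀ q ∈ K, p ≠ q →
      HeisKnot.knotAngle K p q = 0 ∨ HeisKnot.knotAngle K p q = Real.pi) :
    HeisKnot.IsRCircle K ∧
      ∀ p ∈ K, ∀ q ∈ K, p ≠ q → HeisKnot.knotAngle K p q = 0 := by
  obtain ⟨γ, hγ, rfl⟩ := hK
  have hc := hγ.cartan_im_eq_zero fun s t hst => HeisKnot.mixed_im_eq_zero hγ hst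
    (hangle _ (mem_range_self s) _ (mem_range_self t) hst)
  have hR := hγ.isRCircle_range hc
  refine ⟨hR, ?_⟩
  rintro _ ⟨s, rfl⟩ _ ⟨t, rfl⟩ hst
  obtain ⟨δ, s', t', α, β, a, a', b, b', hδ, hr, hs, ht, hα, hβ, hθ⟩ :=
    HeisKnot.isKnotAngle_knotAngle hγ hst
  rw [← ht] at hα
  rw [← hs] at hβ
  have hst' : δ s' ≠ δ t' := by rw [hs, ht]; exact hst
  obtain ⟨z, c, hz, hc0, hang, hm⟩ := HeisKnot.exists_angle_eq hst' hα hβ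
  obtain ⟨ρ, hρ, hm'⟩ := hδ.mixed_pos (fun p q r => by
    rw [← hr] at hR
    exact hR.cartan_im (mem_range_self p) (mem_range_self q) (mem_range_self r)) hst'
  rw [hm'] at hm
  -- On the ℝ-circle `K` the mixed derivative is positive, and it equals `c * conj z` with `c > 0`;
  -- so `z` is positive and the angle is `arccos 1`.
  have hz' : z = ((ρ / c : ℝ) : ℂ) := by
    have hcc : (c : ℂ) ≠ 0 := by exact_mod_cast hc0.ne'
    have := congrArg (starRingEnd ℂ) hm
    simp only [map_mul, Complex.conj_ofReal, Complex.conj_conj] at this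
    push_cast
    rw [this]; field_simp
  have hpos : 0 < ρ / c := div_pos hρ hc0
  rw [hθ, hang, Real.arccos_eq_zero, hz', Complex.ofReal_re, Complex.norm_real,
    Real.norm_of_nonneg hpos.le, div_self hpos.ne']
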